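/- Let $X$ be a complex Banach space, $\mathcal B(X)$ the bounded operators on $X$ with operator norm $\|\cdot\|$, and $\mathcal F(X)$ the finite-rank operators. For $L\in\mathcal B(X)$ let $(\lambda_j(L))$ denote the discrete eigenvalues of $L$ (isolated eigenvalues of finite algebraic multiplicity), counted according to their algebraic multiplicity. For $F\in\mathcal F(X)$ with range $R$ and restriction $F_R:R\to R$ put $\det(I-F):=\det(I_R-F_R)$, $\operatorname{tr}(F):=\operatorname{tr}(F_R)$ and, for $p>0$, $$\det\nolimits_p(I-F):=\det(I-F)\exp\Big(\sum_{k=1}^{\lceil p\rceil-1}\frac1k\operatorname{tr}(F^k)\Big).$$ A quasi-norm on a complex vector space $V$, with quasi-triangle constant $q\ge 1$, is a map $\|\cdot\|_V:V\to[0,\infty)$ with $\|x\|_V=0\iff x=0$, $\|\lambda x\|_V=|\lambda|\|x\|_V$ and $\|x+y\|_V\le q(\|x\|_V+\|y\|_V)$; $V$ carries the topology in which the sets $\{y:\|y-x\|_V<\varepsilon\}$, $\varepsilon>0$, form a neighbourhood basis of $x$. Let $p>0$. An $l_p$-ideal in $\mathcal B(X)$ with eigenvalue constant $\gamma_p$ is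 a linear subspace $\mathcal I$ of $\mathcal B(X)$ with a quasi-norm $\|\cdot\|_{\mathcal I}$ such that: (A1) $\mathcal F(X)\subset\mathcal I$ is dense in $(\mathcal I,\|\cdot\|_{\mathcal I})$; (A2) $\|L\|\le\|L\|_{\mathcal I}$ for $L\in\mathcal I$; (A3) if $L\in\mathcal I$ and $A,B\in\mathcal B(X)$, then $ALB\in\mathcal I$ and $\|ALB\|_{\mathcal I}\le\|A\|\,\|L\|_{\mathcal I}\,\|B\|$; (A4) $\big(\sum_j|\lambda_j(L)|^p\big)^{1/p}\le\gamma_p\|L\|_{\mathcal I}$ for every $L\in\mathcal I$. **Theorem.** Let $p>0$. There is a constant $\Gamma_p>0$, depending only on $p$, such that for every complex Banach space $X$ $$|\det\nolimits_p(I-F)|\le\exp\Big(\Gamma_p\sum_k|\lambda_k(F)|^p\Big)\qquad(F\in\mathcal F(X)).\tag{1}$$ Let $(\mathcal I,\|\cdot\|_{\mathcal I})$ be an $l_p$-ideal in $\mathcal B(X)$ with quasi-triangle constant $q_{\mathcal I}$ and eigenvalue constant $\gamma_p$. Then there exists a unique continuous function $\det_{p,\mathcal I}(I-\,\cdot\,):(\mathcal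 I,\|\cdot\|_{\mathcal I})\to\mathbb C$ such that $\det_{p,\mathcal I}(I-F)=\det_p(I-F)$ for all $F\in\mathcal F(X)$. Moreover, for every constant $\Gamma_p>0$ that satisfies (1) on $X$ and for all $K,L\in\mathcal I$, $$|\det\nolimits_{p,\mathcal I}(I-L)|\le\exp\big(\gamma_p^p\,\Gamma_p\,\|L\|_{\mathcal I}^p\big)$$ and $$|\det\nolimits_{p,\mathcal I}(I-K)-\det\nolimits_{p,\mathcal I}(I-L)|\le\|K-L\|_{\mathcal I}\exp\Big(q_{\mathcal I}^{2p}\,\gamma_p^p\,\Gamma_p\,\big(\|K\|_{\mathcal I}+\|L\|_{\mathcal I}+1\big)^p\Big).$$ -/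

import Mathlib

open scoped ENNReal Topology

universe u

noncomputable section

/-! ### Finite rank operators, their determinant, trace and regularized determinant -/

section FiniteRank

variable {X : Type u} [NormedAddCommGroup X] [NormedSpace ℂ X]

/-- The range `Ran F`, as a linear subspace of `X`. -/
def opRange (F : X →L[ℂ] X) : Submodule ℂ X :=
  LinearMap.range (F : X →ₗ[ℂ] X)

/-- `F` has finite rank: its range is finite-dimensional. -/
def IsFiniteRank (F : X →L[ℂ] X) : Prop :=
  FiniteDimensional ℂ (opRange F)

/-- The restriction `F_R : R → R` of `F` to its (invariant) range `R = Ran F`. -/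
def restrictRange (F : X →L[ℂ] X) : opRange F →ₗ[ℂ] opRange F :=
  (F : X →ₗ[ℂ] X).restrict (p := opRange F) (q := opRange F)
    (fun x _ => LinearMap.mem_range_self (F : X →ₗ[ℂ] X) x)

/-- `det (I - F) = det (I_R - F_R)` for a finite rank operator `F` with range `R`. -/
def detOneSub (F : X →L[ℂ] X) : ℂ :=
  LinearMap.det (LinearMap.id - restrictRange F)

/-- `tr F = tr F_R` for a finite rank operator `F` with range `R`. -/
def finTrace (F : X →L[ℂ] X) : ℂ :=
  LinearMap.trace ℂ (opRange F) (restrictRange F)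

/-- The `p`-regularized determinant of `I - F` for a finite rank operator `F`:
`det (I - F) * exp (∑_{k=1}^{⌈p⌉-1} tr (F^k) / k)`. -/
def regDet (p : ℝ) (F : X →L[ℂ] X) : ℂ :=
  detOneSub F * Complex.exp (∑ k ∈ Finset.Ico 1 ⌈p⌉₊, (1 / (k : ℂ)) * finTrace (F ^ k))

end FiniteRank

/-! ### Discrete eigenvalues -/

section Eigenvalues

variable {X : Type u} [NormedAddCommGroup X] [NormedSpace ℂ X]

/-- The generalized eigenspace `⋃ k, ker (μ - L)^k`. For a compact operator `L` and `μ ≠ 0` in its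
spectrum this is the range of the Riesz projection of `L` at `μ`. -/
def genEigenspaceOf (L : X →L[ℂ] X) (μ : ℂ) : Submodule ℂ X :=
  Module.End.maxGenEigenspace (L : X →ₗ[ℂ] X) μ

/-- The discrete eigenvalues of `L`: the eigenvalues that are isolated points of the spectrum and
have finite algebraic multiplicity. (Whether `0` is included is immaterial for the sums below,
where it contributes `0`.) -/
def discreteSpectrum (L : X →L[ℂ] X) : Set ℂ :=
  {μ | Module.End.HasEigenvalue (L : X →ₗ[ℂ] X) μ ∧
    (∀ᶠ ν in 𝓝[≠] μ, ν ∉ spectrum ℂ L) ∧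
    FiniteDimensional ℂ (genEigenspaceOf L μ)}

/-- `∑ⱼ |λⱼ(L)|^p` in `[0, ∞]`, the sum being over all discrete eigenvalues of `L`, each counted
according to its algebraic multiplicity. -/
def eigenvalueSum (p : ℝ) (L : X →L[ℂ] X) : ℝ≥0∞ :=
  ∑' μ : discreteSpectrum L,
    (Module.finrank ℂ (genEigenspaceOf L (μ : ℂ)) : ℝ≥0∞) * ‖(μ : ℂ)‖ₑ ^ p

end Eigenvalues

/-- `Γ > 0` is an admissible constant in the estimate
`|det_p (I - F)| ≤ exp (Γ ∑ₖ |λₖ(F)|^p)` for all finite rank operators `F` on `X`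
(the sum on the right is finite). -/
def IsGrowthConstant (X : Type u) [NormedAddCommGroup X] [NormedSpace ℂ X] (p Γ : ℝ) : Prop :=
  0 < Γ ∧ ∀ F : X →L[ℂ] X, IsFiniteRank F →
    ‖regDet p F‖ ≤ Real.exp (Γ * (eigenvalueSum p F).toReal)

/-! ### Quasi-norms -/

section QuasiNorm

variable {V : Type u} [AddCommGroup V] [Module ℂ V]

/-- `N` is a quasi-norm on the complex vector space `V`, with quasi-triangle constant `q`. -/
structure IsQuasiNorm (N : V → ℝ) (q : ℝ) : Prop where
  nonneg : ∀ x, 0 ≤ N x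
  eq_zero_iff : ∀ x, N x = 0 ↔ x = 0
  one_le : 1 ≤ q
  add_le : ∀ x y, N (x + y) ≤ q * (N x + N y)
  smul_eq : ∀ (a : ℂ) (x : V), N (a • x) = ‖a‖ * N x

/-- The topology induced by a quasi-norm `N`: a set is open if with each of its points `x` it
contains some `{y | N (y - x) < ε}`, `ε > 0`. -/
@[reducible]
def quasiNormTopology (N : V → ℝ) : TopologicalSpace V where
  IsOpen U := ∀ x ∈ U, ∃ ε > 0, ∀ y, N (y - x) < ε → y ∈ U
  isOpen_univ := fun _ _ => ⟨1, one_pos, fun _ _ => Set.mem_univ _⟩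
  isOpen_inter := by
    intro s t hs ht x hx
    obtain ⟨a, ha, h1⟩ := hs x hx.1
    obtain ⟨b, hb, h2⟩ := ht x hx.2
    exact ⟨min a b, lt_min ha hb, fun y hy =>
      ⟨h1 y (lt_of_lt_of_le hy (min_le_left _ _)), h2 y (lt_of_lt_of_le hy (min_le_right _ _))⟩⟩
  isOpen_sUnion := by
    intro S hS x hx
    obtain ⟨t, ht, hxt⟩ := hx
    obtain ⟨a, ha, h1⟩ := hS t ht x hxt
    exact ⟨a, ha, fun y hy => ⟨t, ht, h1 y hy⟩⟩

/-- For a quasi-norm, the sets `{y | N (y - x) < ε}` form a basis of neighbourhoods of `x`. -/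
theorem mem_nhds_quasiNormTopology {N : V → ℝ} {q : ℝ} (hN : IsQuasiNorm N q) (x : V)
    (s : Set V) :
    s ∈ @nhds V (quasiNormTopology N) x ↔ ∃ ε > 0, ∀ y, N (y - x) < ε → y ∈ s := by
  let _ := quasiNormTopology N
  rw [mem_nhds_iff]
  constructor
  · rintro ⟨t, hts, ht, hx⟩
    obtain ⟨ε, hε, h⟩ := ht x hx
    exact ⟨ε, hε, fun y hy => hts (h y hy)⟩
  · rintro ⟨ε, hε, h⟩
    have hq : 0 < q := lt_of_lt_of_le one_pos hN.one_le
    refine ⟨{y | ∃ δ > 0, ∀ z, N (z - y) < δ → z ∈ s}, ?_, ?_, ⟨ε, hε, h⟩⟩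
    · rintro y ⟨δ, hδ, hy⟩
      exact hy y (by rw [sub_self, (hN.eq_zero_iff 0).2 rfl]; exact hδ)
    · rintro y ⟨δ, hδ, hy⟩
      refine ⟨δ / (2 * q), by positivity, fun z hz => ⟨δ / (2 * q), by positivity, fun v hv => ?_⟩⟩
      apply hy
      have h1 := hN.add_le (v - z) (z - y)
      rw [sub_add_sub_cancel] at h1
      refine lt_of_le_of_lt h1 ?_
      have h2 : q * (N (v - z) + N (z - y)) < q * (δ / (2 * q) + δ / (2 * q)) := by gcongr
      have h3 : q * (δ / (2 * q) + δ / (2 * q)) = δ := by field_simp; norm_num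
      linarith

end QuasiNorm

/-! ### `l_p`-ideals -/

/-- The subspace `𝓘` of `𝓑(X)`, with the quasi-norm `N` of quasi-triangle constant `q`, is an
`l_p`-ideal in `𝓑(X)` with eigenvalue constant `γ`. -/
structure IsLpIdeal {X : Type u} [NormedAddCommGroup X] [NormedSpace ℂ X]
    (p : ℝ) (𝓘 : Submodule ℂ (X →L[ℂ] X)) (N : 𝓘 → ℝ) (q γ : ℝ) : Prop where
  quasiNorm : IsQuasiNorm N q
  finiteRank_mem : ∀ F : X →L[ℂ] X, IsFiniteRank F → F ∈ 𝓘
  finiteRank_dense : @Dense 𝓘 (quasiNormTopology N) {L : 𝓘 | IsFiniteRank (L : X →L[ℂ] X)}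
  opNorm_le : ∀ L : 𝓘, ‖(L : X →L[ℂ] X)‖ ≤ N L
  mul_mem : ∀ (A B : X →L[ℂ] X) (L : 𝓘), A * (L : X →L[ℂ] X) * B ∈ 𝓘
  mul_le : ∀ (A B : X →L[ℂ] X) (L : 𝓘),
    N ⟨A * (L : X →L[ℂ] X) * B, mul_mem A B L⟩ ≤ ‖A‖ * N L * ‖B‖
  eigenvalue_le : ∀ L : 𝓘,
    eigenvalueSum p (L : X →L[ℂ] X) ^ (1 / p) ≤ ENNReal.ofReal (γ * N L)

/-- `D` is a continuous function on `(𝓘, N)` that extends `F ↦ det_p (I - F)` from the finite rank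
operators. -/
def IsContinuousDetExtension {X : Type u} [NormedAddCommGroup X] [NormedSpace ℂ X]
    (p : ℝ) (𝓘 : Submodule ℂ (X →L[ℂ] X)) (N : 𝓘 → ℝ) (D : 𝓘 → ℂ) : Prop :=
  Continuous[quasiNormTopology N, inferInstance] D ∧
    ∀ F : 𝓘, IsFiniteRank (F : X →L[ℂ] X) → D F = regDet p (F : X →L[ℂ] X)

end

/-! For finite rank `F`, `regDet p F` is the product of the Weierstrass factors of genus `⌈p⌉ - 1`
over the nonzero eigenvalues of `F` (`regDet_eq_prod`), so a growth constant is just a bound `|E(u)|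
≤ exp (Γ |u|^p)` for a single factor. With (A4), this bounds `regDet` by `exp (γ^p Γ N(F)^p)`. Along
a complex line through two finite rank operators `regDet` is entire, and Cauchy's estimate on discs
of radius `1 / N (K - L)` turns the growth bound into a local Lipschitz bound. Density then gives
the extension and its uniqueness.

The delicate point is the growth bound for general `L` with no loss of constant. A quasi-norm need
not be continuous, so `N (F n)` need not tend to `N L`. The limit is therefore taken in the
eigenvalues: `IsLpIdeal.norm_le_exp_eigenvalueSum` bounds the extension by the eigenvalue sum of `L`
itself, and (A4) is applied only to `L`. For this the eigenvalues of `F n → L` are split at a radius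
`ρ`. The large ones, boundedly many, accumulate only at eigenvalues of the compact operator `L`,
with no gain of multiplicity, by semicontinuity of kernel dimensions
(`eventually_sum_filter_le_eigenvalueSum`). The small ones must contribute a factor of modulus at
most `exp ε` (`exists_forall_norm_prod_small_le`). For non-integral `p` this is immediate from
`|E(u)| ≤ exp (2 |u|^⌈p⌉)` and `⌈p⌉ > p`.

For integral `p = m` one needs in addition that the sum of `μ^m` over the small eigenvalues is
small. This is an argument in the style of Lindelöf: `F n` is a perturbation of small quasi-norm of
a fixed finite rank operator, and that operator affects the growth of `z ↦ regDet p (z • F n)` only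
in lower order, so these functions are uniformly of minimal type. Multiplying over the `m`-th roots
of unity leaves `∏ (1 - z^m μ^m)`, whose linear coefficient in `z^m` is controlled by
Borel-Carathéodory. Once the growth bound holds on the whole ideal, the Cauchy estimate applied to
the extension gives the difference estimate. -/

/-! ### Characteristic polynomials, kernels and traces in finite dimension. -/

section FiniteDimensional

open Polynomial Module

variable {V : Type u} [AddCommGroup V] [Module ℂ V]

theorem mapQ_aeval {f : V →ₗ[ℂ] V} {W : Submodule ℂ V} (hW : W ≤ W.comap f) (q : ℂ[X]) (x : V) :
    aeval (W.mapQ W f hW) q (W.mkQ x) = W.mkQ (aeval f q x) := by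
  induction q using Polynomial.induction_on' generalizing x with
  | add p q hp hq => rw [map_add, map_add, LinearMap.add_apply, LinearMap.add_apply, hp, hq, map_add]
  | monomial n a =>
    simp only [aeval_monomial, Module.End.mul_apply, Module.algebraMap_end_apply, map_smul]
    congr 1
    induction n generalizing x with
    | zero => simp
    | succ n ih =>
      rw [pow_succ, pow_succ, Module.End.mul_apply, Module.End.mul_apply, ← ih]
      rfl

variable [FiniteDimensional ℂ V]

/-- Evaluated at `t`, both sides are determinants of `t - f`, and the determinant is multiplicative
over an invariant line and its quotient. -/
theorem charpoly_eq_mul_charpoly_mapQ_span {f : V →ₗ[ℂ] V} {μ : ℂ} {v : V}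
    (hv : End.HasEigenvector f μ v) (hW : (ℂ ∙ v) ≤ (ℂ ∙ v).comap f) :
    f.charpoly = (X - C μ) * ((ℂ ∙ v).mapQ (ℂ ∙ v) f hW).charpoly := by
  refine Polynomial.funext fun t => ?_
  have hW' : (ℂ ∙ v) ≤ (ℂ ∙ v).comap (algebraMap ℂ (End ℂ V) t - f) := by
    intro x hx
    simp only [Submodule.mem_comap, LinearMap.sub_apply]
    exact Submodule.sub_mem _ (Submodule.smul_mem _ _ hx) (hW hx)
  rw [eval_mul, LinearMap.eval_charpoly, LinearMap.eval_charpoly,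
    LinearMap.det_eq_det_mul_det (ℂ ∙ v) _ hW']
  congr 1
  · have h1 : LinearMap.restrict (p := ℂ ∙ v) (q := ℂ ∙ v) (algebraMap ℂ (End ℂ V) t - f)
        (fun x hx => hW' hx) = (t - μ) • LinearMap.id := by
      ext ⟨x, hx⟩
      obtain ⟨a, rfl⟩ := Submodule.mem_span_singleton.1 hx
      have := hv.apply_eq_smul
      simp only [LinearMap.restrict_apply, LinearMap.sub_apply, Module.algebraMap_end_apply,
        map_smul, this, LinearMap.smul_apply, LinearMap.id_apply, SetLike.mk_smul_mk]
      module
    rw [h1, LinearMap.det_smul, finrank_span_singleton hv.2]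
    simp
  · congr 1
    apply Submodule.linearMap_qext
    ext x
    simp [Module.algebraMap_end_apply]

theorem roots_charpoly_eq_cons {f : V →ₗ[ℂ] V} {μ : ℂ} {v : V}
    (hv : End.HasEigenvector f μ v) (hW : (ℂ ∙ v) ≤ (ℂ ∙ v).comap f) :
    f.charpoly.roots = μ ::ₘ ((ℂ ∙ v).mapQ (ℂ ∙ v) f hW).charpoly.roots := by
  rw [charpoly_eq_mul_charpoly_mapQ_span hv hW, roots_mul, roots_X_sub_C, Multiset.singleton_add]
  exact mul_ne_zero (X_sub_C_ne_zero μ) (LinearMap.charpoly_monic _).ne_zero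

/-- A product of linear factors over part of the spectrum has a large kernel. -/
theorem card_le_finrank_ker_aeval (t : Multiset ℂ) (f : V →ₗ[ℂ] V) (ht : t ≤ f.charpoly.roots) :
    t.card ≤ finrank ℂ (LinearMap.ker (aeval f (t.map fun a => X - C a).prod)) := by
  induction t using Multiset.induction generalizing V with
  | empty => simp
  | cons μ t ih =>
    have hμ : μ ∈ f.charpoly.roots := Multiset.mem_of_le ht (Multiset.mem_cons_self _ _)
    have hev : End.HasEigenvalue f μ :=
      (Module.End.hasEigenvalue_iff_isRoot_charpoly f μ).2 (isRoot_of_mem_roots hμ)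
    obtain ⟨v, hv⟩ := hev.exists_hasEigenvector
    have hW : (ℂ ∙ v) ≤ (ℂ ∙ v).comap f := by
      rw [Submodule.span_singleton_le_iff_mem, Submodule.mem_comap, hv.apply_eq_smul]
      exact Submodule.smul_mem _ _ (Submodule.mem_span_singleton_self v)
    rw [roots_charpoly_eq_cons hv hW, Multiset.cons_le_cons_iff] at ht
    have h1 := ih _ ht
    set q := (t.map fun a => X - C a).prod
    set K' := LinearMap.ker (aeval ((ℂ ∙ v).mapQ (ℂ ∙ v) f hW) q)
    -- If the class of `x` is killed by `q` on the quotient, then `q(f) x` is a multiple of `v`,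
    -- which the remaining factor `X - μ` kills. The line of `v` supplies the extra dimension in
    -- `h3`.
    have h2 : K'.comap (ℂ ∙ v).mkQ ≤
        LinearMap.ker (aeval f ((μ ::ₘ t).map fun a => X - C a).prod) := by
      intro x hx
      rw [Submodule.mem_comap, LinearMap.mem_ker, mapQ_aeval] at hx
      have hx' : aeval f q x ∈ (ℂ ∙ v) := by simpa using hx
      obtain ⟨a, ha⟩ := Submodule.mem_span_singleton.1 hx'
      rw [LinearMap.mem_ker, Multiset.map_cons, Multiset.prod_cons, map_mul,
        Module.End.mul_apply]
      change (aeval f (X - C μ)) (aeval f q x) = 0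
      rw [← ha]
      simp [hv.apply_eq_smul]
    have h3 : finrank ℂ (K'.comap (ℂ ∙ v).mkQ) = finrank ℂ K' + 1 := by
      have := LinearMap.finrank_range_add_finrank_ker
        ((ℂ ∙ v).mkQ.restrict (p := K'.comap (ℂ ∙ v).mkQ) (q := K') fun x hx => hx)
      have hr : LinearMap.range
          ((ℂ ∙ v).mkQ.restrict (p := K'.comap (ℂ ∙ v).mkQ) (q := K') fun x hx => hx) = ⊤ := by
        rw [LinearMap.range_eq_top]
        rintro ⟨y, hy⟩
        obtain ⟨x, rfl⟩ := (ℂ ∙ v).mkQ_surjective y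
        exact ⟨⟨x, hy⟩, rfl⟩
      rw [hr, finrank_top] at this
      have hk : finrank ℂ (LinearMap.ker
          ((ℂ ∙ v).mkQ.restrict (p := K'.comap (ℂ ∙ v).mkQ) (q := K') fun x hx => hx)) = 1 := by
        have hle : (ℂ ∙ v) ≤ K'.comap (ℂ ∙ v).mkQ := by
          intro x hx
          rw [Submodule.mem_comap]
          have : (ℂ ∙ v).mkQ x = 0 := by simpa using hx
          rw [this]
          exact zero_mem _
        have he : LinearMap.ker
          ((ℂ ∙ v).mkQ.restrict (p := K'.comap (ℂ ∙ v).mkQ) (q := K') fun x hx => hx) =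
            (ℂ ∙ v).comap (K'.comap (ℂ ∙ v).mkQ).subtype := by
          ext ⟨x, hx⟩
          rw [LinearMap.mem_ker, LinearMap.restrict_apply, ← Subtype.coe_inj]
          simp
        rw [he, (Submodule.comapSubtypeEquivOfLe hle).finrank_eq, finrank_span_singleton hv.2]
      omega
    calc (μ ::ₘ t).card = t.card + 1 := by simp
      _ ≤ finrank ℂ (K'.comap (ℂ ∙ v).mkQ) := by omega
      _ ≤ _ := Submodule.finrank_mono h2

/-- On the generalized eigenspace `f - μ` is nilpotent and commutes with powers of `f`, so under the
trace each factor `f` may be replaced by `μ`. -/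
theorem trace_pow_restrict_maxGenEigenspace (f : End ℂ V) (μ : ℂ) (k : ℕ)
    (h : Set.MapsTo (f ^ k) (End.maxGenEigenspace f μ) (End.maxGenEigenspace f μ)) :
    LinearMap.trace ℂ _ ((f ^ k).restrict h) = f.charpoly.rootMultiplicity μ * μ ^ k := by
  have hf := f.mapsTo_maxGenEigenspace_of_comm (Commute.refl f) μ
  have hnil := f.isNilpotent_restrict_maxGenEigenspace_sub_algebraMap μ
  have hpow : (f ^ k).restrict h = (f.restrict hf) ^ k := (Module.End.pow_restrict k hf).symm
  rw [hpow]
  clear hpow h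
  induction k with
  | zero =>
    rw [pow_zero, LinearMap.trace_one, LinearMap.finrank_maxGenEigenspace_eq]
    simp
  | succ k ih =>
    have h2 := LinearMap.trace_comp_eq_mul_of_commute_of_isNilpotent (R := ℂ) μ
      ((Commute.refl (f.restrict hf)).pow_left k) hnil
    rw [pow_succ, ← Module.End.mul_eq_comp] at *
    rw [h2, ih]
    ring

theorem trace_pow_eq_sum_roots (f : End ℂ V) (k : ℕ) :
    LinearMap.trace ℂ V (f ^ k) = (f.charpoly.roots.map (· ^ k)).sum := by
  classical
  have hds := DirectSum.isInternal_submodule_of_iSupIndep_of_iSup_eq_top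
    f.independent_maxGenEigenspace (Module.End.iSup_maxGenEigenspace_eq_top f)
  have hfin : {μ | End.maxGenEigenspace f μ ≠ ⊥}.Finite :=
    WellFoundedGT.finite_ne_bot_of_iSupIndep f.independent_maxGenEigenspace
  have hmaps : ∀ μ, Set.MapsTo (f ^ k) (End.maxGenEigenspace f μ) (End.maxGenEigenspace f μ) :=
    fun μ => f.mapsTo_maxGenEigenspace_of_comm ((Commute.refl f).pow_right k) μ
  rw [LinearMap.trace_eq_sum_trace_restrict' hds hfin hmaps, Finset.sum_multiset_map_count]
  simp_rw [trace_pow_restrict_maxGenEigenspace, count_roots, nsmul_eq_mul]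
  symm
  apply Finset.sum_subset
  · intro μ hμ
    rw [Set.Finite.mem_toFinset, Set.mem_ofPred_eq]
    intro hbot
    have h1 := LinearMap.finrank_maxGenEigenspace_eq f μ
    rw [hbot, finrank_bot] at h1
    rw [Multiset.mem_toFinset, ← Multiset.count_pos, count_roots] at hμ
    omega
  · intro μ _ hμ
    rw [Multiset.mem_toFinset, ← Multiset.count_eq_zero, count_roots] at hμ
    simp [hμ]

theorem det_one_sub_eq_prod_roots (f : V →ₗ[ℂ] V) :
    LinearMap.det (LinearMap.id - f) = (f.charpoly.roots.map (1 - ·)).prod := by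
  have h : LinearMap.id - f = algebraMap ℂ (End ℂ V) 1 - f := by simp; rfl
  rw [h, ← LinearMap.eval_charpoly]
  conv_lhs => rw [(IsAlgClosed.splits f.charpoly).eq_prod_roots_of_monic f.charpoly_monic]
  rw [eval_multiset_prod, Multiset.map_map]
  simp

end FiniteDimensional

/-! ### Determinants and traces of linear pencils as polynomials. -/

section PencilPolynomial

open Polynomial Module

variable {V : Type u} [AddCommGroup V] [Module ℂ V] [FiniteDimensional ℂ V]

/-- Every term of the Leibniz expansion takes one entry from each column, and column `i` has degree
at most `d i`. -/
theorem natDegree_det_pencil_le {n : Type*} [Fintype n] [DecidableEq n] (A B : Matrix n n ℂ)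
    (d : n → ℕ) (hd : ∀ i, d i = 0 → ∀ j, B j i = 0) :
    natDegree (A.map C + (X : ℂ[X]) • B.map C : Matrix n n ℂ[X]).det ≤ ∑ i, d i := by
  rw [Matrix.det_apply]
  refine natDegree_sum_le_of_forall_le _ _ fun g _ => ?_
  calc natDegree (Equiv.Perm.sign g •
        ∏ i : n, (A.map C + (X : ℂ[X]) • B.map C : Matrix n n ℂ[X]) (g i) i)
      ≤ natDegree (∏ i : n, (A.map C + (X : ℂ[X]) • B.map C : Matrix n n ℂ[X]) (g i) i) := by
        rcases Int.units_eq_one_or (Equiv.Perm.sign g) with sg | sg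
        · rw [sg, one_smul]
        · rw [sg, Units.neg_smul, one_smul, natDegree_neg]
    _ ≤ ∑ i : n, natDegree ((A.map C + (X : ℂ[X]) • B.map C : Matrix n n ℂ[X]) (g i) i) :=
        natDegree_prod_le _ _
    _ ≤ ∑ i, d i := by
        refine Finset.sum_le_sum fun i _ => ?_
        simp only [Matrix.add_apply, Matrix.smul_apply, Matrix.map_apply, smul_eq_mul]
        rcases Nat.eq_zero_or_pos (d i) with h | h
        · rw [hd i h, h]; simp
        · refine le_trans ?_ (Nat.succ_le_of_lt h)
          compute_degree

/-- In a basis adapted to `ker b` and a complement, the columns of `b` on the kernel vanish, so only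
rank-many columns depend on `z`. The degree bound by the rank, rather than by `dim V`, is what later
controls finite rank perturbations. -/
theorem exists_polynomial_det_pencil (a b : V →ₗ[ℂ] V) :
    ∃ P : ℂ[X], P.natDegree ≤ finrank ℂ (LinearMap.range b) ∧
      ∀ z : ℂ, LinearMap.det (LinearMap.id - (a + z • b)) = P.eval z := by
  classical
  obtain ⟨W, hW⟩ := (LinearMap.ker b).exists_isCompl
  let e := ((finBasis ℂ (LinearMap.ker b)).prod (finBasis ℂ W)).map
    (Submodule.prodEquivOfIsCompl _ _ hW)
  let A := LinearMap.toMatrix e e (LinearMap.id - a)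
  let B := LinearMap.toMatrix e e (-b)
  refine ⟨(A.map C + (X : ℂ[X]) • B.map C).det, ?_, fun z => ?_⟩
  · refine (natDegree_det_pencil_le A B (Sum.elim (fun _ => 0) fun _ => 1) ?_).trans ?_
    · rintro (i | i) hi j
      · have : b (e (Sum.inl i)) = 0 := by simp [e]
        simp [B, LinearMap.toMatrix_apply, this]
      · simp at hi
    · have h1 := Submodule.finrank_add_eq_of_isCompl hW
      have h2 := LinearMap.finrank_range_add_finrank_ker b
      simp only [Fintype.sum_sum_type, Sum.elim_inl, Sum.elim_inr, Finset.sum_const,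
        Finset.card_univ, Fintype.card_fin, smul_eq_mul, mul_zero, mul_one, zero_add]
      omega
  · have h : (eval z) (A.map C + (X : ℂ[X]) • B.map C).det =
        (A + z • B).det := by
      rw [← coe_evalRingHom, RingHom.map_det]
      congr 1
      ext i j
      simp
      ring
    rw [h, ← LinearMap.det_toMatrix e]
    congr 1
    simp only [A, B, map_sub, map_add, map_smul, map_neg]
    module

theorem exists_polynomial_trace_pencil_pow (a b : V →ₗ[ℂ] V) (k : ℕ) :
    ∃ P : ℂ[X], ∀ z : ℂ, LinearMap.trace ℂ V ((a + z • b : End ℂ V) ^ k) = P.eval z := by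
  classical
  let e := finBasis ℂ V
  let A := LinearMap.toMatrix e e a
  let B := LinearMap.toMatrix e e b
  refine ⟨((A.map C + (X : ℂ[X]) • B.map C) ^ k).trace, fun z => ?_⟩
  have h : (A.map C + (X : ℂ[X]) • B.map C).map (evalRingHom z) = A + z • B := by
    ext i j
    simp
    ring
  rw [LinearMap.trace_eq_matrix_trace ℂ e, ← LinearMap.toMatrix_pow, ← coe_evalRingHom,
    AddMonoidHom.map_trace, ← RingHom.mapMatrix_apply, map_pow, RingHom.mapMatrix_apply, h]
  simp [A, B]

end PencilPolynomial

/-! ### Nonzero eigenvalues, determinant and trace of finite rank operators. -/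

section FiniteRankOperators

open Module

variable {X : Type u} [NormedAddCommGroup X] [NormedSpace ℂ X]

theorem opRange_add_le (A B : X →L[ℂ] X) : opRange (A + B) ≤ opRange A ⊔ opRange B := by
  rintro _ ⟨x, rfl⟩
  exact Submodule.add_mem_sup ⟨x, rfl⟩ ⟨x, rfl⟩

theorem opRange_smul_le (c : ℂ) (A : X →L[ℂ] X) : opRange (c • A) ≤ opRange A := by
  rintro _ ⟨x, rfl⟩
  exact ⟨c • x, by simp⟩

theorem opRange_mul_le (A B : X →L[ℂ] X) : opRange (A * B) ≤ opRange A := by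
  rintro _ ⟨x, rfl⟩
  exact ⟨B x, rfl⟩

theorem opRange_pow_le (A : X →L[ℂ] X) {k : ℕ} (hk : k ≠ 0) : opRange (A ^ k) ≤ opRange A := by
  obtain ⟨n, rfl⟩ := Nat.exists_eq_succ_of_ne_zero hk
  rw [pow_succ']
  exact opRange_mul_le _ _

theorem opRange_mul_eq_map (A B : X →L[ℂ] X) :
    opRange (A * B) = (opRange B).map (A : X →ₗ[ℂ] X) := by
  ext x
  simp [opRange]

theorem IsFiniteRank.of_le {A B : X →L[ℂ] X} (hB : IsFiniteRank B) (h : opRange A ≤ opRange B) :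
    IsFiniteRank A := by
  have : FiniteDimensional ℂ (opRange B) := hB
  exact Submodule.finiteDimensional_of_le h

theorem IsFiniteRank.add {A B : X →L[ℂ] X} (hA : IsFiniteRank A) (hB : IsFiniteRank B) :
    IsFiniteRank (A + B) := by
  have : FiniteDimensional ℂ (opRange A) := hA
  have : FiniteDimensional ℂ (opRange B) := hB
  exact Submodule.finiteDimensional_of_le (opRange_add_le A B)

theorem IsFiniteRank.smul {A : X →L[ℂ] X} (hA : IsFiniteRank A) (c : ℂ) :
    IsFiniteRank (c • A) := hA.of_le (opRange_smul_le c A)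

theorem IsFiniteRank.neg {A : X →L[ℂ] X} (hA : IsFiniteRank A) : IsFiniteRank (-A) := by
  simpa using hA.smul (-1)

theorem IsFiniteRank.sub {A B : X →L[ℂ] X} (hA : IsFiniteRank A) (hB : IsFiniteRank B) :
    IsFiniteRank (A - B) := by
  simpa [sub_eq_add_neg] using hA.add hB.neg

theorem IsFiniteRank.mul_right {A : X →L[ℂ] X} (hA : IsFiniteRank A) (B : X →L[ℂ] X) :
    IsFiniteRank (A * B) := hA.of_le (opRange_mul_le A B)

theorem IsFiniteRank.mul_left {B : X →L[ℂ] X} (hB : IsFiniteRank B) (A : X →L[ℂ] X) :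
    IsFiniteRank (A * B) := by
  have : FiniteDimensional ℂ (opRange B) := hB
  unfold IsFiniteRank
  rw [opRange_mul_eq_map]
  infer_instance

theorem IsFiniteRank.pow {A : X →L[ℂ] X} (hA : IsFiniteRank A) {k : ℕ} (hk : k ≠ 0) :
    IsFiniteRank (A ^ k) := hA.of_le (opRange_pow_le A hk)

/-- The restriction of `F` to a subspace containing its range. -/
def restrictTo (F : X →L[ℂ] X) (V : Submodule ℂ X) (hV : opRange F ≤ V) : V →ₗ[ℂ] V :=
  (F : X →ₗ[ℂ] X).restrict (p := V) (q := V) fun x _ => hV (LinearMap.mem_range_self _ x)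

theorem restrictTo_opRange (F : X →L[ℂ] X) : restrictTo F (opRange F) le_rfl = restrictRange F :=
  rfl

@[simp]
theorem coe_restrictTo_apply (F : X →L[ℂ] X) (V : Submodule ℂ X) (hV : opRange F ≤ V) (x : V) :
    (restrictTo F V hV x : X) = F x := rfl

/-- Since `μ x = F x - (F - μ) x` and `F x` lies in `V`, membership passes from `(F - μ) x` to `x`.
-/
theorem genEigenspaceOf_le {F : X →L[ℂ] X} {V : Submodule ℂ X} (hV : opRange F ≤ V) {μ : ℂ}
    (hμ : μ ≠ 0) : genEigenspaceOf F μ ≤ V := by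
  intro x hx
  obtain ⟨k, hk⟩ := (Module.End.mem_maxGenEigenspace _ _ _).1 hx
  clear hx
  induction k generalizing x with
  | zero =>
    have : x = 0 := by simpa using hk
    rw [this]
    exact zero_mem _
  | succ k ih =>
    rw [pow_succ, Module.End.mul_apply] at hk
    have h1 := ih hk
    have h2 : F x ∈ V := hV ⟨x, rfl⟩
    have h3 : μ • x ∈ V := by
      have h4 := V.sub_mem h2 h1
      simpa using h4
    simpa [hμ] using V.smul_mem μ⁻¹ h3

theorem rootMultiplicity_charpoly_restrictTo {F : X →L[ℂ] X} {V : Submodule ℂ X}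
    [FiniteDimensional ℂ V] (hV : opRange F ≤ V) {μ : ℂ} (hμ : μ ≠ 0) :
    (restrictTo F V hV).charpoly.rootMultiplicity μ = finrank ℂ (genEigenspaceOf F μ) := by
  rw [← LinearMap.finrank_maxGenEigenspace_eq]
  have h : End.maxGenEigenspace (restrictTo F V hV) μ =
      (genEigenspaceOf F μ).comap V.subtype :=
    Module.End.genEigenspace_restrict _ _ _ _ _
  rw [h, (Submodule.comapSubtypeEquivOfLe (genEigenspaceOf_le hV hμ)).finrank_eq]

open Classical in
/-- The nonzero eigenvalues of a finite rank operator, counted with algebraic multiplicity. -/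
noncomputable def nonzeroEigenvalues (F : X →L[ℂ] X) : Multiset ℂ :=
  if h : IsFiniteRank F then
    haveI : FiniteDimensional ℂ (opRange F) := h
    (restrictRange F).charpoly.roots.filter (· ≠ 0)
  else 0

/-- Generalized eigenspaces at nonzero points already lie in the range, so a larger `V` only adds
roots at `0`. Hence several operators can be handled on one common space. -/
theorem nonzeroEigenvalues_eq {F : X →L[ℂ] X} {V : Submodule ℂ X} [FiniteDimensional ℂ V]
    (hV : opRange F ≤ V) :
    nonzeroEigenvalues F = (restrictTo F V hV).charpoly.roots.filter (· ≠ 0) := by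
  have hF : IsFiniteRank F := Submodule.finiteDimensional_of_le hV
  have : FiniteDimensional ℂ (opRange F) := hF
  rw [nonzeroEigenvalues, dif_pos hF]
  ext μ
  rcases eq_or_ne μ 0 with rfl | hμ
  · rw [Multiset.count_filter_of_neg, Multiset.count_filter_of_neg] <;> simp
  · rw [Multiset.count_filter_of_pos (p := (· ≠ 0)) hμ, Multiset.count_filter_of_pos (p := (· ≠ 0)) hμ, Polynomial.count_roots,
      Polynomial.count_roots, rootMultiplicity_charpoly_restrictTo hV hμ, ← restrictTo_opRange]
    exact rootMultiplicity_charpoly_restrictTo le_rfl hμ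

theorem ne_zero_of_mem_nonzeroEigenvalues {F : X →L[ℂ] X} {μ : ℂ}
    (h : μ ∈ nonzeroEigenvalues F) : μ ≠ 0 := by
  rw [nonzeroEigenvalues] at h
  split_ifs at h with hF
  · exact (Multiset.mem_filter.1 h).2
  · simp at h

theorem count_nonzeroEigenvalues {F : X →L[ℂ] X} (hF : IsFiniteRank F) {μ : ℂ} (hμ : μ ≠ 0) :
    (nonzeroEigenvalues F).count μ = finrank ℂ (genEigenspaceOf F μ) := by
  have : FiniteDimensional ℂ (opRange F) := hF
  rw [nonzeroEigenvalues_eq le_rfl, Multiset.count_filter_of_pos (p := (· ≠ 0)) hμ, Polynomial.count_roots,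
    rootMultiplicity_charpoly_restrictTo le_rfl hμ]

theorem card_nonzeroEigenvalues_le {F : X →L[ℂ] X} (hF : IsFiniteRank F) :
    (nonzeroEigenvalues F).card ≤ finrank ℂ (opRange F) := by
  have : FiniteDimensional ℂ (opRange F) := hF
  rw [nonzeroEigenvalues_eq le_rfl, ← LinearMap.charpoly_natDegree (restrictTo F _ le_rfl)]
  exact (Multiset.card_le_card (Multiset.filter_le _ _)).trans (Polynomial.card_roots' _)

theorem hasEigenvalue_of_mem_nonzeroEigenvalues {F : X →L[ℂ] X} (hF : IsFiniteRank F) {μ : ℂ}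
    (h : μ ∈ nonzeroEigenvalues F) : End.HasEigenvalue (F : X →ₗ[ℂ] X) μ := by
  have : FiniteDimensional ℂ (opRange F) := hF
  rw [nonzeroEigenvalues_eq le_rfl] at h
  have h1 := (Module.End.hasEigenvalue_iff_isRoot_charpoly _ μ).2
    (Polynomial.isRoot_of_mem_roots (Multiset.mem_filter.1 h).1)
  obtain ⟨v, hv⟩ := h1.exists_hasEigenvector
  refine End.hasEigenvalue_of_hasEigenvector (x := (v : X)) ⟨?_, by simpa using hv.2⟩
  rw [End.mem_genEigenspace_one]
  have := congrArg (Subtype.val) hv.apply_eq_smul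
  simpa using this

theorem norm_le_of_hasEigenvalue {F : X →L[ℂ] X} {μ : ℂ}
    (h : End.HasEigenvalue (F : X →ₗ[ℂ] X) μ) : ‖μ‖ ≤ ‖F‖ := by
  obtain ⟨v, hv⟩ := h.exists_hasEigenvector
  have h1 : F v = μ • v := hv.apply_eq_smul
  have h2 := F.le_opNorm v
  rw [h1, norm_smul] at h2
  exact le_of_mul_le_mul_right h2 (norm_pos_iff.2 hv.2)

theorem prod_map_roots_eq {M : Type*} [CommMonoid M] {F : X →L[ℂ] X} {V : Submodule ℂ X}
    [FiniteDimensional ℂ V] (hV : opRange F ≤ V) (g : ℂ → M) (hg : g 0 = 1) :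
    ((restrictTo F V hV).charpoly.roots.map g).prod = ((nonzeroEigenvalues F).map g).prod := by
  rw [nonzeroEigenvalues_eq hV]
  conv_lhs => rw [← Multiset.filter_add_not (· ≠ 0) (restrictTo F V hV).charpoly.roots]
  rw [Multiset.map_add, Multiset.prod_add]
  convert mul_one _
  refine Multiset.prod_eq_one fun x hx => ?_
  obtain ⟨y, hy, rfl⟩ := Multiset.mem_map.1 hx
  have : y = 0 := by simpa using (Multiset.mem_filter.1 hy).2
  rw [this, hg]

theorem sum_map_roots_eq {F : X →L[ℂ] X} {V : Submodule ℂ X}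
    [FiniteDimensional ℂ V] (hV : opRange F ≤ V) (g : ℂ → ℂ) (hg : g 0 = 0) :
    ((restrictTo F V hV).charpoly.roots.map g).sum = ((nonzeroEigenvalues F).map g).sum := by
  have := prod_map_roots_eq hV (fun x => Multiplicative.ofAdd (g x)) (by simp [hg])
  apply_fun Multiplicative.toAdd at this
  simpa [toAdd_multiset_sum] using this

theorem detOneSub_eq_prod {F : X →L[ℂ] X} (hF : IsFiniteRank F) :
    detOneSub F = ((nonzeroEigenvalues F).map (1 - ·)).prod := by
  have : FiniteDimensional ℂ (opRange F) := hF
  rw [detOneSub, det_one_sub_eq_prod_roots, ← restrictTo_opRange, prod_map_roots_eq]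
  simp

theorem detOneSub_eq_det {F : X →L[ℂ] X} {V : Submodule ℂ X} [FiniteDimensional ℂ V]
    (hV : opRange F ≤ V) :
    detOneSub F = LinearMap.det (LinearMap.id - restrictTo F V hV) := by
  rw [detOneSub_eq_prod (Submodule.finiteDimensional_of_le hV), det_one_sub_eq_prod_roots,
    prod_map_roots_eq]
  simp

theorem finTrace_eq_sum {F : X →L[ℂ] X} (hF : IsFiniteRank F) :
    finTrace F = (nonzeroEigenvalues F).sum := by
  have : FiniteDimensional ℂ (opRange F) := hF
  rw [finTrace, Module.End.trace_eq_sum_roots_charpoly_of_splits (IsAlgClosed.splits _)]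
  have h := sum_map_roots_eq (F := F) le_rfl id rfl
  rw [restrictTo_opRange] at h
  simpa using h

theorem finTrace_eq_trace {F : X →L[ℂ] X} {V : Submodule ℂ X} [FiniteDimensional ℂ V]
    (hV : opRange F ≤ V) : finTrace F = LinearMap.trace ℂ V (restrictTo F V hV) := by
  rw [finTrace_eq_sum (Submodule.finiteDimensional_of_le hV),
    Module.End.trace_eq_sum_roots_charpoly_of_splits (IsAlgClosed.splits _)]
  simpa using (sum_map_roots_eq hV id rfl).symm

theorem finTrace_pow_eq_trace {F : X →L[ℂ] X} {V : Submodule ℂ X} [FiniteDimensional ℂ V]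
    (hV : opRange F ≤ V) {k : ℕ} (hk : k ≠ 0) :
    finTrace (F ^ k) = LinearMap.trace ℂ V ((restrictTo F V hV : End ℂ V) ^ k) := by
  rw [finTrace_eq_trace ((opRange_pow_le F hk).trans hV)]
  congr 1
  refine LinearMap.ext fun x => Subtype.ext ?_
  rw [coe_restrictTo_apply]
  clear hk
  induction k generalizing x with
  | zero => simp
  | succ k ih =>
    rw [pow_succ, pow_succ, Module.End.mul_apply, ← ih, coe_restrictTo_apply,
      mul_apply_eq_comp]

theorem finTrace_pow_eq_sum {F : X →L[ℂ] X} (hF : IsFiniteRank F) {k : ℕ} (hk : k ≠ 0) :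
    finTrace (F ^ k) = ((nonzeroEigenvalues F).map (· ^ k)).sum := by
  have : FiniteDimensional ℂ (opRange F) := hF
  rw [finTrace_pow_eq_trace le_rfl hk, trace_pow_eq_sum_roots, sum_map_roots_eq]
  simp [hk]

theorem finTrace_add {A B : X →L[ℂ] X} (hA : IsFiniteRank A) (hB : IsFiniteRank B) :
    finTrace (A + B) = finTrace A + finTrace B := by
  have : FiniteDimensional ℂ (opRange A) := hA
  have : FiniteDimensional ℂ (opRange B) := hB
  rw [finTrace_eq_trace (opRange_add_le A B), finTrace_eq_trace (le_sup_left : _ ≤ _ ⊔ opRange B),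
    finTrace_eq_trace (le_sup_right : _ ≤ opRange A ⊔ _), ← map_add]
  rfl

/-- The trace is a sum of at most `r` nonzero eigenvalues, each bounded by the operator norm. -/
theorem norm_finTrace_le {F : X →L[ℂ] X} (hF : IsFiniteRank F) {r : ℕ}
    (hr : finrank ℂ (opRange F) ≤ r) : ‖finTrace F‖ ≤ r * ‖F‖ := by
  rw [finTrace_eq_sum hF]
  calc ‖(nonzeroEigenvalues F).sum‖ ≤ ((nonzeroEigenvalues F).map (‖·‖)).sum :=
        norm_multiset_sum_le _
    _ ≤ (nonzeroEigenvalues F).card • ‖F‖ := by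
        have := Multiset.sum_le_card_nsmul ((nonzeroEigenvalues F).map (‖·‖)) ‖F‖ (by
          intro x hx
          obtain ⟨y, hy, rfl⟩ := Multiset.mem_map.1 hx
          exact norm_le_of_hasEigenvalue (hasEigenvalue_of_mem_nonzeroEigenvalues hF hy))
        simpa using this
    _ ≤ r * ‖F‖ := by
        rw [nsmul_eq_mul]
        gcongr
        exact (card_nonzeroEigenvalues_le hF).trans hr

theorem exists_polynomial_detOneSub {A B : X →L[ℂ] X} (hA : IsFiniteRank A)
    (hB : IsFiniteRank B) : ∃ P : Polynomial ℂ, P.natDegree ≤ finrank ℂ (opRange B) ∧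
      ∀ z : ℂ, detOneSub (A + z • B) = P.eval z := by
  have : FiniteDimensional ℂ (opRange A) := hA
  have : FiniteDimensional ℂ (opRange B) := hB
  let V := opRange A ⊔ opRange B
  have hAV : opRange A ≤ V := le_sup_left
  have hBV : opRange B ≤ V := le_sup_right
  obtain ⟨P, hP, h⟩ := exists_polynomial_det_pencil (restrictTo A V hAV) (restrictTo B V hBV)
  refine ⟨P, hP.trans ?_, fun z => ?_⟩
  · have h1 : (LinearMap.range (restrictTo B V hBV)).map V.subtype ≤ opRange B := by
      rintro _ ⟨_, ⟨x, rfl⟩, rfl⟩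
      exact ⟨x, rfl⟩
    exact (Submodule.finrank_map_subtype_eq V _).symm.le.trans (Submodule.finrank_mono h1)
  · have hz : opRange (A + z • B) ≤ V :=
      (opRange_add_le _ _).trans (sup_le hAV ((opRange_smul_le z B).trans hBV))
    rw [detOneSub_eq_det hz, ← h]
    rfl

theorem exists_polynomial_finTrace_pow {A B : X →L[ℂ] X} (hA : IsFiniteRank A)
    (hB : IsFiniteRank B) {k : ℕ} (hk : k ≠ 0) :
    ∃ P : Polynomial ℂ, ∀ z : ℂ, finTrace ((A + z • B) ^ k) = P.eval z := by
  have : FiniteDimensional ℂ (opRange A) := hA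
  have : FiniteDimensional ℂ (opRange B) := hB
  let V := opRange A ⊔ opRange B
  have hAV : opRange A ≤ V := le_sup_left
  have hBV : opRange B ≤ V := le_sup_right
  obtain ⟨P, h⟩ := exists_polynomial_trace_pencil_pow (restrictTo A V hAV) (restrictTo B V hBV) k
  refine ⟨P, fun z => ?_⟩
  have hz : opRange (A + z • B) ≤ V :=
    (opRange_add_le _ _).trans (sup_le hAV ((opRange_smul_le z B).trans hBV))
  rw [finTrace_pow_eq_trace hz hk, ← h]
  rfl

theorem differentiable_regDet_pencil (p : ℝ) {A B : X →L[ℂ] X} (hA : IsFiniteRank A)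
    (hB : IsFiniteRank B) : Differentiable ℂ fun z : ℂ => regDet p (A + z • B) := by
  unfold regDet
  obtain ⟨P, -, hP⟩ := exists_polynomial_detOneSub hA hB
  refine Differentiable.mul ?_ (Differentiable.cexp (Differentiable.fun_sum fun k hk => ?_))
  · simp_rw [hP]
    exact P.differentiable
  · obtain ⟨Q, hQ⟩ := exists_polynomial_finTrace_pow hA hB
      (Nat.one_le_iff_ne_zero.1 (Finset.mem_Ico.1 hk).1)
    simp_rw [hQ]
    exact Q.differentiable.const_mul _

end FiniteRankOperators

/-! ### Riesz theory: kernels and discrete eigenvalues of compact operators. -/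

section CompactOperators

open Module Filter

variable {X : Type u} [NormedAddCommGroup X] [NormedSpace ℂ X]

theorem IsFiniteRank.isCompactOperator {F : X →L[ℂ] X} (hF : IsFiniteRank F) :
    IsCompactOperator F := by
  have : FiniteDimensional ℂ (opRange F) := hF
  have : ProperSpace (opRange F) := FiniteDimensional.proper ℂ (opRange F)
  let G : X →L[ℂ] opRange F := F.codRestrict (opRange F) fun x => ⟨x, rfl⟩
  have hι : IsCompactOperator (opRange F).subtypeL :=
    isCompactOperator_of_locallyCompactSpace_rng _
  exact hι.comp_clm G

/-- A compact operator does not admit an infinite strictly increasing chain of closed invariant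
subspaces on whose successive quotients it acts by scalars bounded away from zero. -/
theorem IsCompactOperator.false_of_chain {L : X →L[ℂ] X} (hL : IsCompactOperator L)
    (W : ℕ → Submodule ℂ X) (hclosed : ∀ n, IsClosed (W n : Set X)) (hlt : ∀ n, W n < W (n + 1))
    (hinv : ∀ n, ∀ x ∈ W n, L x ∈ W n) {r : ℝ} (hr : 0 < r) (ν : ℕ → ℂ) (hν : ∀ n, r ≤ ‖ν n‖)
    (hquot : ∀ n, ∀ x ∈ W (n + 1), L x - ν n • x ∈ W n) : False := by
  have hmono : Monotone W := monotone_nat_of_le_succ fun n => (hlt n).le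
  -- Riesz's lemma in unnormalized form: vectors of norm at most `3` at distance at least `1` from
  -- the preceding subspace.
  have hx : ∀ n, ∃ x ∈ W (n + 1), ‖x‖ ≤ 3 ∧ ∀ y ∈ W n, 1 ≤ ‖x - y‖ := by
    intro n
    have h₁ : IsClosed ((W n).comap (W (n + 1)).subtype : Set (W (n + 1))) :=
      (hclosed n).preimage continuous_subtype_val
    have h₂ : ∃ x : W (n + 1), x ∉ (W n).comap (W (n + 1)).subtype := by
      obtain ⟨x, hx, hx'⟩ := Set.exists_of_ssubset (hlt n)
      exact ⟨⟨x, hx⟩, hx'⟩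
    obtain ⟨⟨x, hx⟩, hxn, hxy⟩ := riesz_lemma_of_norm_lt (c := (2 : ℂ)) (by norm_num)
      (R := 3) (by norm_num) h₁ h₂
    refine ⟨x, hx, hxn, fun y hy => ?_⟩
    simpa using hxy ⟨y, (hlt n).le hy⟩ hy
  choose x hxW hx3 hxfar using hx
  -- Modulo `W n`, `L (x n) - L (x m)` is `ν n • x n`, so the images stay `r` apart, which
  -- contradicts compactness.
  have hsep : ∀ m n, m < n → r ≤ ‖L (x n) - L (x m)‖ := by
    intro m n hmn
    have hν0 : ν n ≠ 0 := norm_pos_iff.1 (hr.trans_le (hν n))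
    have hmem : -(L (x n) - ν n • x n) + L (x m) ∈ W n :=
      (W n).add_mem ((W n).neg_mem (hquot n _ (hxW n)))
        (hinv n _ (hmono (Nat.succ_le_of_lt hmn) (hxW m)))
    have h := hxfar n _ ((W n).smul_mem (ν n)⁻¹ hmem)
    have he : L (x n) - L (x m) =
        ν n • (x n - (ν n)⁻¹ • (-(L (x n) - ν n • x n) + L (x m))) := by
      rw [smul_sub, smul_inv_smul₀ hν0]
      abel
    rw [he, norm_smul]
    calc r ≤ ‖ν n‖ * 1 := by simpa using hν n
      _ ≤ _ := by gcongr
  obtain ⟨K, hK, hK'⟩ := hL.image_closedBall_subset_compact (𝕜₁ := ℂ) (f := (L : X →ₗ[ℂ] X)) 3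
  obtain ⟨y, -, ψ, hψ, hψy⟩ := hK.tendsto_subseq (x := fun n => L (x n))
    (fun n => hK' ⟨x n, by simpa using hx3 n, rfl⟩)
  have hC := hψy.cauchySeq
  rw [Metric.cauchySeq_iff'] at hC
  obtain ⟨N, hN⟩ := hC r hr
  have h1 := hN (N + 1) (Nat.le_succ N)
  rw [dist_eq_norm] at h1
  exact absurd (hsep _ _ (hψ (Nat.lt_succ_self N))) (not_le.2 h1)

/-- On the kernel of `T` the compact operator `T - c` acts as `-c`, so the identity of the kernel is
compact. -/
theorem finiteDimensional_ker_of_isCompactOperator_sub {T : X →L[ℂ] X} {c : ℂ} (hc : c ≠ 0)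
    (hT : IsCompactOperator (T - c • (1 : X →L[ℂ] X))) :
    FiniteDimensional ℂ (LinearMap.ker (T : X →ₗ[ℂ] X)) := by
  set Z := LinearMap.ker (T : X →ₗ[ℂ] X)
  have hZ : ∀ x ∈ Z, T x = 0 := fun x hx => hx
  have hval : ∀ x ∈ Z, ((T - c • (1 : X →L[ℂ] X) : X →L[ℂ] X) : X →ₗ[ℂ] X) x = -(c • x) := by
    intro x hx
    simp [hZ x hx]
  have hmem : ∀ x ∈ Z, ((T - c • (1 : X →L[ℂ] X) : X →L[ℂ] X) : X →ₗ[ℂ] X) x ∈ Z := by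
    intro x hx
    rw [hval x hx]
    exact Z.neg_mem (Z.smul_mem _ hx)
  have hclosed : IsClosed (Z : Set X) := T.isClosed_ker
  have h := IsCompactOperator.restrict (f := ((T - c • (1 : X →L[ℂ] X) : X →L[ℂ] X) : X →ₗ[ℂ] X))
    hT hmem hclosed
  have h2 := h.smul (-c⁻¹)
  refine FiniteDimensional.of_isCompactOperator_id (𝕜 := ℂ) (E := Z) ?_
  suffices he : (id : Z → Z) = -c⁻¹ • ⇑(LinearMap.restrict _ hmem) by rw [he]; exact h2
  funext x
  refine Subtype.ext ?_
  simp only [id_eq, Pi.smul_apply, Submodule.coe_smul]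
  rw [LinearMap.restrict_apply]
  simp only [hval x x.2]
  simp [hc]

/-- Otherwise there are unit vectors `y n` in `Y` with `T (y n) → 0`. As `c y = T y - (T - c) y`,
compactness makes a subsequence converge, and its limit is a unit vector in `ker T ∩ Y`. -/
theorem exists_mul_norm_le_of_disjoint_ker {T : X →L[ℂ] X} {c : ℂ} (hc : c ≠ 0)
    (hT : IsCompactOperator (T - c • (1 : X →L[ℂ] X))) {Y : Submodule ℂ X}
    (hY : IsClosed (Y : Set X)) (hdisj : Disjoint (LinearMap.ker (T : X →ₗ[ℂ] X)) Y) :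
    ∃ ε > 0, ∀ y ∈ Y, ε * ‖y‖ ≤ ‖T y‖ := by
  by_contra! hcon
  have hseq : ∀ n : ℕ, ∃ y ∈ Y, ‖y‖ = 1 ∧ ‖T y‖ < 1 / ((n : ℝ) + 1) := by
    intro n
    obtain ⟨y, hyY, hy⟩ := hcon (1 / ((n : ℝ) + 1)) (by positivity)
    have hy0 : 0 < ‖y‖ := by
      rcases (norm_nonneg y).eq_or_lt with h | h
      · rw [← h, mul_zero] at hy
        exact absurd hy (not_lt.2 (norm_nonneg _))
      · exact h
    refine ⟨((‖y‖⁻¹ : ℝ) : ℂ) • y, Y.smul_mem _ hyY, ?_, ?_⟩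
    · rw [norm_smul]
      simp [hy0.ne']
    · rw [map_smul, norm_smul]
      simp only [Complex.norm_real, norm_inv, norm_norm]
      rw [inv_mul_lt_iff₀ hy0, mul_comm]
      exact hy
  choose y hyY hy1 hyT using hseq
  obtain ⟨K, hK, hK'⟩ := hT.image_closedBall_subset_compact (𝕜₁ := ℂ)
    (f := ((T - c • (1 : X →L[ℂ] X) : X →L[ℂ] X) : X →ₗ[ℂ] X)) 1
  obtain ⟨w, -, ψ, hψ, hψw⟩ := hK.tendsto_subseq
    (x := fun n => (T - c • (1 : X →L[ℂ] X)) (y n))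
    (fun n => hK' ⟨y n, by simp [hy1 n], rfl⟩)
  have hT0 : Tendsto (fun n => T (y n)) atTop (𝓝 0) :=
    squeeze_zero_norm (fun n => (hyT n).le) tendsto_one_div_add_atTop_nhds_zero_nat
  have hlim : Tendsto (fun n => y (ψ n)) atTop (𝓝 (c⁻¹ • (0 - w))) := by
    have h1 := ((hT0.comp hψ.tendsto_atTop).sub hψw).const_smul c⁻¹
    refine h1.congr fun n => ?_
    simp [hc]
  set v := c⁻¹ • (0 - w)
  have hv1 : ‖v‖ = 1 := tendsto_nhds_unique hlim.norm (by simp [hy1])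
  have hvY : v ∈ Y := hY.mem_of_tendsto hlim (Eventually.of_forall fun n => hyY _)
  have hvT : T v = 0 := tendsto_nhds_unique
    ((T.continuous.tendsto v).comp hlim) (hT0.comp hψ.tendsto_atTop)
  have : v = 0 := (Submodule.disjoint_def.1 hdisj) v hvT hvY
  rw [this, norm_zero] at hv1
  exact zero_ne_one hv1

/-- Upper semicontinuity of the dimension of the kernel at `c + K` with `K` compact, `c ≠ 0`. -/
theorem exists_forall_finrank_le_finrank_ker {T : X →L[ℂ] X} {c : ℂ} (hc : c ≠ 0)
    (hT : IsCompactOperator (T - c • (1 : X →L[ℂ] X))) :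
    ∃ δ > 0, ∀ T' : X →L[ℂ] X, ‖T' - T‖ < δ → ∀ M : Submodule ℂ X,
      M ≤ LinearMap.ker (T' : X →ₗ[ℂ] X) →
        finrank ℂ M ≤ finrank ℂ (LinearMap.ker (T : X →ₗ[ℂ] X)) := by
  have hfd := finiteDimensional_ker_of_isCompactOperator_sub hc hT
  obtain ⟨Y, hYc, hY⟩ :=
    (Submodule.ClosedComplemented.of_finiteDimensional
      (LinearMap.ker (T : X →ₗ[ℂ] X))).exists_isClosed_isCompl
  obtain ⟨ε, hε, h⟩ := exists_mul_norm_le_of_disjoint_ker hc hT hYc hY.disjoint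
  refine ⟨ε, hε, fun T' hT' M hM => ?_⟩
  -- The projection onto `ker T` along `Y` is injective on `M`: a nonzero `x ∈ M ∩ Y` would satisfy
  -- `ε ‖x‖ ≤ ‖T x‖ = ‖(T' - T) x‖ < ε ‖x‖`.
  let π := (Submodule.projectionOnto _ _ hY).comp M.subtype
  refine LinearMap.finrank_le_finrank_of_injective (f := π) ?_
  rw [← LinearMap.ker_eq_bot, LinearMap.ker_eq_bot']
  rintro ⟨x, hx⟩ hπ
  have hxY : x ∈ Y := by
    rw [← Submodule.ker_projectionOnto hY]
    exact hπ
  have hxT : T' x = 0 := hM hx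
  have h1 := h x hxY
  have h2 : ‖T x‖ ≤ ‖T' - T‖ * ‖x‖ := by
    have := (T' - T).le_opNorm x
    simpa [hxT] using this
  have h3 : x = 0 := by
    by_contra hx0
    have : ‖T' - T‖ * ‖x‖ < ε * ‖x‖ := by
      have := norm_pos_iff.2 hx0
      gcongr
    linarith
  exact Subtype.ext h3

/-- A factor `L` splits off from `q(L) - q(0)`. This brings `(L - μ)^k` into the form nonzero scalar
plus compact when `μ ≠ 0`. -/
theorem isCompactOperator_aeval_sub {L : X →L[ℂ] X} (hL : IsCompactOperator L)
    (q : Polynomial ℂ) :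
    IsCompactOperator (Polynomial.aeval L q - q.coeff 0 • (1 : X →L[ℂ] X)) := by
  have h : Polynomial.aeval L q - q.coeff 0 • (1 : X →L[ℂ] X) =
      Polynomial.aeval L q.divX * L := by
    conv_lhs => rw [← Polynomial.divX_mul_X_add q]
    simp [Algebra.algebraMap_eq_smul_one]
  rw [h]
  exact hL.clm_comp (Polynomial.aeval L q.divX)

theorem coe_aeval (L : X →L[ℂ] X) (q : Polynomial ℂ) :
    ((Polynomial.aeval L q : X →L[ℂ] X) : X →ₗ[ℂ] X) =
      Polynomial.aeval (L : X →ₗ[ℂ] X) q :=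
  (Polynomial.aeval_algHom_apply ({ ContinuousLinearMap.toLinearMapRingHom with
    commutes' := fun _ => rfl } : (X →L[ℂ] X) →ₐ[ℂ] (X →ₗ[ℂ] X)) L q).symm

theorem ker_aeval_X_sub_C_pow (L : X →L[ℂ] X) (μ : ℂ) (k : ℕ) :
    LinearMap.ker ((Polynomial.aeval L ((Polynomial.X - Polynomial.C μ) ^ k) : X →L[ℂ] X) :
      X →ₗ[ℂ] X) = End.genEigenspace (L : X →ₗ[ℂ] X) μ k := by
  rw [coe_aeval, Module.End.genEigenspace_nat]
  simp [Algebra.algebraMap_eq_smul_one]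

theorem coeff_zero_X_sub_C_pow_ne_zero {μ : ℂ} (hμ : μ ≠ 0) (k : ℕ) :
    ((Polynomial.X - Polynomial.C μ) ^ k : Polynomial ℂ).coeff 0 ≠ 0 := by
  rw [Polynomial.coeff_zero_eq_eval_zero]
  simp [hμ]

theorem IsCompactOperator.finiteDimensional_genEigenspace {L : X →L[ℂ] X}
    (hL : IsCompactOperator L) {μ : ℂ} (hμ : μ ≠ 0) (k : ℕ) :
    FiniteDimensional ℂ (End.genEigenspace (L : X →ₗ[ℂ] X) μ k) := by
  rw [← ker_aeval_X_sub_C_pow]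
  exact finiteDimensional_ker_of_isCompactOperator_sub (coeff_zero_X_sub_C_pow_ne_zero hμ k)
    (isCompactOperator_aeval_sub hL _)

/-- If the kernels of `(L - μ)^k` never stabilize, they form a chain excluded by `false_of_chain`;
if they do, the union is one of them. -/
theorem IsCompactOperator.finiteDimensional_genEigenspaceOf {L : X →L[ℂ] X}
    (hL : IsCompactOperator L) {μ : ℂ} (hμ : μ ≠ 0) :
    FiniteDimensional ℂ (genEigenspaceOf L μ) := by
  by_cases hstab : ∃ k : ℕ, End.genEigenspace (L : X →ₗ[ℂ] X) μ k =
      End.genEigenspace (L : X →ₗ[ℂ] X) μ (k + 1 : ℕ)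
  · obtain ⟨k, hk⟩ := hstab
    have hall : ∀ n x, x ∈ End.genEigenspace (L : X →ₗ[ℂ] X) μ (n : ℕ) →
        x ∈ End.genEigenspace (L : X →ₗ[ℂ] X) μ k := by
      intro n
      rcases le_total n k with h | h
      · exact fun x hx => (End.genEigenspace (L : X →ₗ[ℂ] X) μ).mono (by exact_mod_cast h) hx
      · induction n, h using Nat.le_induction with
        | base => exact fun x hx => hx
        | succ n hn ih =>
          intro x hx
          rw [hk]
          rw [End.mem_genEigenspace_nat, LinearMap.mem_ker, pow_succ, Module.End.mul_apply] at hx ⊢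
          have := ih _ (by rw [End.mem_genEigenspace_nat, LinearMap.mem_ker]; exact hx)
          rwa [End.mem_genEigenspace_nat, LinearMap.mem_ker] at this
    have hle : genEigenspaceOf L μ ≤ End.genEigenspace (L : X →ₗ[ℂ] X) μ k := by
      intro x hx
      obtain ⟨n, hn⟩ := (Module.End.mem_maxGenEigenspace _ _ _).1 hx
      exact hall n x (by rw [End.mem_genEigenspace_nat, LinearMap.mem_ker]; exact hn)
    have := hL.finiteDimensional_genEigenspace hμ k
    exact Submodule.finiteDimensional_of_le hle
  · push Not at hstab
    exfalso
    refine hL.false_of_chain (fun k => End.genEigenspace (L : X →ₗ[ℂ] X) μ (k : ℕ))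
      (fun k => ?_) (fun k => ?_) (fun k x hx => ?_) (norm_pos_iff.2 hμ) (fun _ => μ)
      (fun _ => le_rfl) (fun k x hx => ?_)
    · rw [← ker_aeval_X_sub_C_pow]
      exact ContinuousLinearMap.isClosed_ker _
    · refine lt_of_le_of_ne ((End.genEigenspace (L : X →ₗ[ℂ] X) μ).mono ?_) (hstab k)
      exact_mod_cast Nat.le_succ k
    · exact End.mapsTo_genEigenspace_of_comm (Commute.refl _) μ _ hx
    · rw [End.mem_genEigenspace_nat, LinearMap.mem_ker] at hx ⊢
      rw [pow_succ, Module.End.mul_apply] at hx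
      simpa using hx

/-- Eigenvectors for infinitely many distinct such eigenvalues are independent, and their successive
spans form a chain excluded by `false_of_chain`. -/
theorem IsCompactOperator.finite_eigenvalues {L : X →L[ℂ] X} (hL : IsCompactOperator L) {r : ℝ}
    (hr : 0 < r) : {ν : ℂ | End.HasEigenvalue (L : X →ₗ[ℂ] X) ν ∧ r ≤ ‖ν‖}.Finite := by
  by_contra hinf
  let ν := Set.Infinite.natEmbedding _ hinf
  have hev : ∀ n, End.HasEigenvalue (L : X →ₗ[ℂ] X) (ν n) := fun n => (ν n).2.1
  choose v hv using fun n => (hev n).exists_hasEigenvector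
  have hli : LinearIndependent ℂ v :=
    End.eigenvectors_linearIndependent' (L : X →ₗ[ℂ] X) (fun n => (ν n : ℂ))
      (Subtype.val_injective.comp ν.injective) v hv
  have hLv : ∀ n, L (v n) = (ν n : ℂ) • v n := fun n => (hv n).apply_eq_smul
  have hsucc : ∀ n : ℕ, v '' Set.Iio (n + 1) = insert (v n) (v '' Set.Iio n) := by
    intro n
    rw [← Set.image_insert_eq]
    congr 1
    ext m
    simp only [Set.mem_Iio, Set.mem_insert_iff]
    omega
  have hinv : ∀ n : ℕ, ∀ x ∈ Submodule.span ℂ (v '' Set.Iio n),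
      L x ∈ Submodule.span ℂ (v '' Set.Iio n) := by
    intro n x hx
    have : Submodule.span ℂ (v '' Set.Iio n) ≤
        (Submodule.span ℂ (v '' Set.Iio n)).comap (L : X →ₗ[ℂ] X) := by
      rw [Submodule.span_le]
      rintro _ ⟨m, hm, rfl⟩
      change L (v m) ∈ Submodule.span ℂ (v '' Set.Iio n)
      rw [hLv]
      exact Submodule.smul_mem _ _ (Submodule.subset_span ⟨m, hm, rfl⟩)
    exact this hx
  have hnot : ∀ n : ℕ, v n ∉ Submodule.span ℂ (v '' Set.Iio n) := fun n =>
    hli.notMem_span_image (by simp)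
  refine hL.false_of_chain (fun n => Submodule.span ℂ (v '' Set.Iio n)) (fun n => ?_)
    (fun n => ?_) hinv hr (fun n => ν n) (fun n => (ν n).2.2) (fun n x hx => ?_)
  · have : FiniteDimensional ℂ (Submodule.span ℂ (v '' Set.Iio n)) :=
      FiniteDimensional.span_of_finite ℂ ((Set.finite_Iio n).image v)
    exact Submodule.closed_of_finiteDimensional _
  · refine lt_of_le_of_ne (Submodule.span_mono (Set.image_mono fun m hm =>
      Set.mem_Iio.2 ((Set.mem_Iio.1 hm).trans (Nat.lt_succ_self n)))) fun heq => ?_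
    have h1 : v n ∈ Submodule.span ℂ (v '' Set.Iio n) := by
      rw [heq]
      exact Submodule.subset_span ⟨n, Nat.lt_succ_self n, rfl⟩
    exact hnot n h1
  · simp only [hsucc, Submodule.mem_span_insert] at hx
    obtain ⟨a, z, hz, rfl⟩ := hx
    have : L (a • v n + z) - (ν n : ℂ) • (a • v n + z) = L z - (ν n : ℂ) • z := by
      rw [map_add, map_smul, hLv]
      module
    rw [this]
    exact Submodule.sub_mem _ (hinv n z hz) (Submodule.smul_mem _ _ hz)

/-- By the Fredholm alternative the spectrum near `μ` consists of eigenvalues, and only finitely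
many have modulus at least `‖μ‖ / 2`. -/
theorem IsCompactOperator.mem_discreteSpectrum [CompleteSpace X] {L : X →L[ℂ] X}
    (hL : IsCompactOperator L) {μ : ℂ} (hμ : μ ≠ 0)
    (hev : End.HasEigenvalue (L : X →ₗ[ℂ] X) μ) : μ ∈ discreteSpectrum L := by
  refine ⟨hev, ?_, hL.finiteDimensional_genEigenspaceOf hμ⟩
  have hμ' : 0 < ‖μ‖ := norm_pos_iff.2 hμ
  have hfin := (hL.finite_eigenvalues (half_pos hμ')).sdiff (t := {μ})
  have h1 : ∀ᶠ ν in 𝓝 μ, ‖μ‖ / 2 < ‖ν‖ :=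
    continuous_norm.continuousAt.eventually_const_lt (half_lt_self hμ')
  have h2 : ∀ᶠ ν in 𝓝 μ, ν ∉ {ν : ℂ | End.HasEigenvalue (L : X →ₗ[ℂ] X) ν ∧ ‖μ‖ / 2 ≤ ‖ν‖} \ {μ} :=
    hfin.isClosed.isOpen_compl.mem_nhds (by simp)
  filter_upwards [nhdsWithin_le_nhds h1, nhdsWithin_le_nhds h2, self_mem_nhdsWithin]
    with ν hν1 hν2 hν3 hspec
  have hν0 : ν ≠ 0 := norm_pos_iff.1 ((half_pos hμ').trans hν1)
  exact hν2 ⟨⟨(hL.hasEigenvalue_iff_mem_spectrum hν0).2 hspec, hν1.le⟩, hν3⟩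

end CompactOperators

/-! ### Limits of eigenvalues and of eigenvalue sums. -/

section EigenvalueSum

open Module Filter

variable {X : Type u} [NormedAddCommGroup X] [NormedSpace ℂ X]

theorem tendsto_aeval_prod_X_sub_C {ι : Type*} {F : ℕ → X →L[ℂ] X} {L : X →L[ℂ] X}
    (hF : Tendsto F atTop (𝓝 L)) {a : ℕ → ι → ℂ} {μ : ℂ} (S : Finset ι)
    (ha : ∀ i ∈ S, Tendsto (fun n => a n i) atTop (𝓝 μ)) :
    Tendsto (fun n => Polynomial.aeval (F n) (∏ i ∈ S, (Polynomial.X - Polynomial.C (a n i))))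
      atTop (𝓝 (Polynomial.aeval L ((Polynomial.X - Polynomial.C μ) ^ S.card))) := by
  classical
  induction S using Finset.induction_on with
  | empty => simp
  | insert i S hi ih =>
    simp only [Finset.prod_insert hi, map_mul, Finset.card_insert_of_notMem hi, pow_succ']
    refine Tendsto.mul ?_ (ih fun j hj => ha j (Finset.mem_insert_of_mem hj))
    simp only [map_sub, Polynomial.aeval_X, Polynomial.aeval_C, Algebra.algebraMap_eq_smul_one]
    exact hF.sub ((ha i (Finset.mem_insert_self _ _)).smul_const _)

/-- If `c` eigenvalues of `F n` converge to `μ ≠ 0` and `F n → L` with `L` compact, then `μ` is an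
eigenvalue of `L` of algebraic multiplicity at least `c`. -/
theorem card_le_finrank_genEigenspaceOf_of_tendsto {ι : Type*} {F : ℕ → X →L[ℂ] X}
    {L : X →L[ℂ] X} (hL : IsCompactOperator L) (hFr : ∀ n, IsFiniteRank (F n))
    (hF : Tendsto F atTop (𝓝 L)) {a : ℕ → ι → ℂ} {μ : ℂ} (hμ : μ ≠ 0) (S : Finset ι)
    (hsub : ∀ n, S.val.map (a n) ≤ nonzeroEigenvalues (F n))
    (ha : ∀ i ∈ S, Tendsto (fun n => a n i) atTop (𝓝 μ)) :
    S.card ≤ finrank ℂ (genEigenspaceOf L μ) := by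
  have := hL.finiteDimensional_genEigenspaceOf hμ
  -- Semicontinuity is applied at `(L - μ)^S.card`, the norm limit of the products of `F n - a n i`;
  -- each of these has a kernel of dimension at least `S.card`.
  obtain ⟨δ, hδ, h⟩ := exists_forall_finrank_le_finrank_ker
    (coeff_zero_X_sub_C_pow_ne_zero hμ S.card) (isCompactOperator_aeval_sub hL _)
  have hlim := tendsto_aeval_prod_X_sub_C hF S ha
  obtain ⟨n, hn⟩ := ((tendsto_iff_norm_sub_tendsto_zero.1 hlim).eventually_lt_const hδ).exists
  have : FiniteDimensional ℂ (opRange (F n)) := hFr n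
  set q := ∏ i ∈ S, (Polynomial.X - Polynomial.C (a n i)) with hq
  have h1 := card_le_finrank_ker_aeval (S.val.map (a n)) (restrictTo (F n) _ le_rfl) (by
    refine (hsub n).trans ?_
    rw [nonzeroEigenvalues_eq le_rfl]
    exact Multiset.filter_le _ _)
  rw [Multiset.map_map, Multiset.card_map] at h1
  change S.card ≤ finrank ℂ (LinearMap.ker (Polynomial.aeval (restrictTo (F n) _ le_rfl) q)) at h1
  have h2 : (LinearMap.ker (Polynomial.aeval (restrictTo (F n) _ le_rfl) q)).map
      (opRange (F n)).subtype ≤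
      LinearMap.ker ((Polynomial.aeval (F n) q : X →L[ℂ] X) : X →ₗ[ℂ] X) := by
    rintro _ ⟨x, hx, rfl⟩
    rw [coe_aeval, LinearMap.mem_ker]
    have h3 : ∀ r : Polynomial ℂ, ∀ x : opRange (F n),
        ((Polynomial.aeval (restrictTo (F n) _ le_rfl) r x : opRange (F n)) : X) =
          Polynomial.aeval ((F n : X →L[ℂ] X) : X →ₗ[ℂ] X) r (x : X) := by
      intro r
      induction r using Polynomial.induction_on' with
      | add r s hr hs => intro x; simp [hr, hs]
      | monomial k c =>
        intro x
        simp only [Polynomial.aeval_monomial, Module.End.mul_apply,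
          Module.algebraMap_end_apply, Submodule.coe_smul]
        congr 1
        induction k generalizing x with
        | zero => simp
        | succ k ih =>
          rw [pow_succ, pow_succ, Module.End.mul_apply, Module.End.mul_apply, ih]
          rfl
    have h4 := h3 q x
    rw [(LinearMap.mem_ker.1 hx)] at h4
    exact h4.symm
  calc S.card ≤ _ := h1
    _ = finrank ℂ ((LinearMap.ker (Polynomial.aeval (restrictTo (F n) _ le_rfl) q)).map
        (opRange (F n)).subtype) := (Submodule.finrank_map_subtype_eq _ _).symm
    _ ≤ _ := h _ hn _ h2
    _ = finrank ℂ (End.genEigenspace (L : X →ₗ[ℂ] X) μ (S.card : ℕ)) := by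
      rw [ker_aeval_X_sub_C_pow]
    _ ≤ finrank ℂ (genEigenspaceOf L μ) :=
      Submodule.finrank_mono (End.genEigenspace_le_maximal _ μ _)

variable [CompleteSpace X]

theorem eigenvalueSum_eq_sum {p : ℝ} (hp : 0 < p) {F : X →L[ℂ] X} (hF : IsFiniteRank F) :
    eigenvalueSum p F = ((nonzeroEigenvalues F).map fun μ => ‖μ‖ₑ ^ p).sum := by
  classical
  rw [eigenvalueSum, tsum_subtype (discreteSpectrum F)
    (fun μ : ℂ => (finrank ℂ (genEigenspaceOf F μ) : ℝ≥0∞) * ‖μ‖ₑ ^ p),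
    tsum_eq_sum (s := (nonzeroEigenvalues F).toFinset), Finset.sum_multiset_map_count]
  · refine Finset.sum_congr rfl fun μ hμ => ?_
    rw [Multiset.mem_toFinset] at hμ
    have hμ0 := ne_zero_of_mem_nonzeroEigenvalues hμ
    rw [Set.indicator_of_mem (hF.isCompactOperator.mem_discreteSpectrum hμ0
      (hasEigenvalue_of_mem_nonzeroEigenvalues hF hμ)), count_nonzeroEigenvalues hF hμ0,
      nsmul_eq_mul]
  · intro μ hμ
    rw [Multiset.mem_toFinset, ← Multiset.count_eq_zero] at hμ
    refine Set.indicator_apply_eq_zero.2 fun _ => ?_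
    rcases eq_or_ne μ 0 with rfl | hμ0
    · simp [hp]
    · rw [count_nonzeroEigenvalues hF hμ0] at hμ
      simp [hμ]

theorem toReal_sum_map_enorm_rpow {p : ℝ} (hp : 0 < p) (s : Multiset ℂ) :
    (s.map fun μ => ‖μ‖ₑ ^ p).sum = ENNReal.ofReal (s.map fun μ => ‖μ‖ ^ p).sum := by
  induction s using Multiset.induction with
  | empty => simp
  | cons a s ih =>
    have h0 : 0 ≤ (s.map fun μ => ‖μ‖ ^ p).sum := Multiset.sum_nonneg (by
      intro x hx
      obtain ⟨y, -, rfl⟩ := Multiset.mem_map.1 hx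
      positivity)
    rw [Multiset.map_cons, Multiset.sum_cons, ih, Multiset.map_cons, Multiset.sum_cons,
      ENNReal.ofReal_add (by positivity) h0, ← ENNReal.ofReal_rpow_of_nonneg (norm_nonneg _) hp.le,
      ofReal_norm]

theorem sum_map_norm_rpow_nonneg (p : ℝ) (s : Multiset ℂ) :
    0 ≤ (s.map fun μ => ‖μ‖ ^ p).sum := Multiset.sum_nonneg (by
  intro x hx
  obtain ⟨y, -, rfl⟩ := Multiset.mem_map.1 hx
  positivity)

theorem toReal_eigenvalueSum {p : ℝ} (hp : 0 < p) {F : X →L[ℂ] X} (hF : IsFiniteRank F) :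
    (eigenvalueSum p F).toReal = ((nonzeroEigenvalues F).map fun μ => ‖μ‖ ^ p).sum := by
  rw [eigenvalueSum_eq_sum hp hF, toReal_sum_map_enorm_rpow hp,
    ENNReal.toReal_ofReal (sum_map_norm_rpow_nonneg p _)]

/-- Several sequences may share a limit. Grouping the `b i` by value, each value is attained at most
as often as its algebraic multiplicity in `L`. -/
theorem sum_le_eigenvalueSum_of_tendsto {k : ℕ} (p : ℝ) {F : ℕ → X →L[ℂ] X}
    {L : X →L[ℂ] X} (hL : IsCompactOperator L) (hFr : ∀ n, IsFiniteRank (F n))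
    (hF : Tendsto F atTop (𝓝 L)) {a : ℕ → Fin k → ℂ} {b : Fin k → ℂ} (hb : ∀ i, b i ≠ 0)
    (hsub : ∀ n, Finset.univ.val.map (a n) ≤ nonzeroEigenvalues (F n))
    (ha : Tendsto a atTop (𝓝 b)) :
    ∑ i, ‖b i‖ₑ ^ p ≤ eigenvalueSum p L := by
  classical
  have hmult : ∀ μ : ℂ, μ ≠ 0 →
      (Finset.univ.filter fun i => b i = μ).card ≤ finrank ℂ (genEigenspaceOf L μ) := by
    intro μ hμ
    refine card_le_finrank_genEigenspaceOf_of_tendsto hL hFr hF hμ _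
      (fun n => (Multiset.map_le_map ?_).trans (hsub n)) (fun i hi => ?_)
    · exact Finset.val_le_iff.2 (Finset.filter_subset _ _)
    · rw [← (Finset.mem_filter.1 hi).2]
      exact (tendsto_pi_nhds.1 ha) i
  have himg : ∀ μ ∈ Finset.univ.image b, μ ∈ discreteSpectrum L := by
    intro μ hμ
    obtain ⟨i, -, rfl⟩ := Finset.mem_image.1 hμ
    refine hL.mem_discreteSpectrum (hb i) ?_
    have h1 : 1 ≤ finrank ℂ (genEigenspaceOf L (b i)) :=
      (Finset.card_pos.2 ⟨i, by simp⟩).trans_le (hmult (b i) (hb i))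
    rw [End.hasEigenvalue_iff]
    intro hbot
    have h2 : genEigenspaceOf L (b i) = ⊥ := by
      by_contra h3
      obtain ⟨x, hx, hx0⟩ := Submodule.exists_mem_ne_zero_of_ne_bot h3
      obtain ⟨n, hn⟩ := (Module.End.mem_maxGenEigenspace _ _ _).1 hx
      have hinj : Function.Injective ((L : X →ₗ[ℂ] X) - b i • (1 : End ℂ X)) := by
        rw [← LinearMap.ker_eq_bot, ← End.eigenspace_def, hbot]
      have : Function.Injective (((L : X →ₗ[ℂ] X) - b i • (1 : End ℂ X)) ^ n) := by
        rw [Module.End.coe_pow]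
        exact hinj.iterate n
      exact hx0 (this (by rw [hn, map_zero]))
    rw [h2, finrank_bot] at h1
    omega
  calc ∑ i, ‖b i‖ₑ ^ p
      = ∑ μ ∈ Finset.univ.image b,
          ((Finset.univ.filter fun i => b i = μ).card : ℝ≥0∞) * ‖μ‖ₑ ^ p := by
        rw [Finset.sum_comp (fun μ : ℂ => ‖μ‖ₑ ^ p) b]
        simp [nsmul_eq_mul]
    _ ≤ ∑ μ ∈ Finset.univ.image b,
          (discreteSpectrum L).indicator
            (fun μ => (finrank ℂ (genEigenspaceOf L μ) : ℝ≥0∞) * ‖μ‖ₑ ^ p) μ := by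
        refine Finset.sum_le_sum fun μ hμ => ?_
        rw [Set.indicator_of_mem (himg μ hμ)]
        obtain ⟨i, -, rfl⟩ := Finset.mem_image.1 hμ
        gcongr
        exact hmult _ (hb i)
    _ ≤ ∑' μ, (discreteSpectrum L).indicator
            (fun μ => (finrank ℂ (genEigenspaceOf L μ) : ℝ≥0∞) * ‖μ‖ₑ ^ p) μ :=
        ENNReal.sum_le_tsum _
    _ = eigenvalueSum p L := (tsum_subtype _ _).symm

theorem exists_fin_map_eq {α : Type*} (s : Multiset α) {k : ℕ} (h : s.card = k) :
    ∃ f : Fin k → α, Finset.univ.val.map f = s := by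
  subst h
  induction s using Quotient.inductionOn with
  | h l =>
    refine ⟨l.get, ?_⟩
    exact (Fin.univ_val_map l.get).trans (congrArg _ (List.ofFn_get l))

/-- The eigenvalues away from zero do not gain mass in the limit. -/
theorem eventually_sum_filter_le_eigenvalueSum {p : ℝ} (hp : 0 < p) {F : ℕ → X →L[ℂ] X}
    {L : X →L[ℂ] X} (hL : IsCompactOperator L) (hFr : ∀ n, IsFiniteRank (F n))
    (hF : Tendsto F atTop (𝓝 L)) (hfin : eigenvalueSum p L ≠ ∞) {ρ : ℝ} (hρ : 0 < ρ) {K : ℕ}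
    (hK : ∀ᶠ n in atTop, ((nonzeroEigenvalues (F n)).filter fun μ => ρ ≤ ‖μ‖).card ≤ K)
    {ε : ℝ} (hε : 0 < ε) :
    ∀ᶠ n in atTop, (((nonzeroEigenvalues (F n)).filter fun μ => ρ ≤ ‖μ‖).map
      fun μ => ‖μ‖ ^ p).sum ≤ (eigenvalueSum p L).toReal + ε := by
  by_contra hcon
  rw [not_eventually] at hcon
  have hB : ∀ᶠ n in atTop, ‖F n‖ ≤ ‖L‖ + 1 :=
    (hF.norm.eventually_lt_const (lt_add_one ‖L‖)).mono fun n hn => hn.le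
  -- Pigeonhole on the number of large eigenvalues: with this number fixed at `k`, they form a
  -- bounded sequence in `ℂ^k` and have a convergent subsequence.
  have hcon2 : ∃ k ≤ K, ∃ᶠ n in atTop,
      (((nonzeroEigenvalues (F n)).filter fun μ => ρ ≤ ‖μ‖).card = k ∧ ‖F n‖ ≤ ‖L‖ + 1) ∧
      ¬ (((nonzeroEigenvalues (F n)).filter fun μ => ρ ≤ ‖μ‖).map
      fun μ => ‖μ‖ ^ p).sum ≤ (eigenvalueSum p L).toReal + ε := by
    by_contra! h
    have h1 : ∀ᶠ n in atTop, ∀ k ∈ Finset.range (K + 1),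
      ¬ ((((nonzeroEigenvalues (F n)).filter fun μ => ρ ≤ ‖μ‖).card = k ∧ ‖F n‖ ≤ ‖L‖ + 1) ∧
      ¬ (((nonzeroEigenvalues (F n)).filter fun μ => ρ ≤ ‖μ‖).map
      fun μ => ‖μ‖ ^ p).sum ≤ (eigenvalueSum p L).toReal + ε) := by
      rw [eventually_all_finset]
      intro k hk
      refine (h k (Nat.lt_succ_iff.1 (Finset.mem_range.1 hk))).mono fun n hn hn' => ?_
      exact hn'.2 (hn hn'.1)
    obtain ⟨n, hn, ⟨h2, h3⟩, h4⟩ := (hcon.and_eventually ((h1.and hB).and hK)).exists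
    exact h2 _ (Finset.mem_range.2 (Nat.lt_succ_of_le h4)) ⟨⟨rfl, h3⟩, hn⟩
  obtain ⟨k, -, hfreq⟩ := hcon2
  obtain ⟨φ, hφ, hP⟩ := extraction_of_frequently_atTop hfreq
  choose a ha using fun n => exists_fin_map_eq _ (hP n).1.1
  have hmem : ∀ n i, a n i ∈ (nonzeroEigenvalues (F (φ n))).filter fun μ => ρ ≤ ‖μ‖ := by
    intro n i
    rw [← ha n]
    exact Multiset.mem_map_of_mem _ (Finset.mem_univ i)
  have hcpt : IsCompact (Set.univ.pi fun _ : Fin k => Metric.closedBall (0 : ℂ) (‖L‖ + 1)) :=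
    isCompact_univ_pi fun _ => isCompact_closedBall _ _
  obtain ⟨b, -, ψ, hψ, hψb⟩ := hcpt.tendsto_subseq (x := a) (fun n i _ => by
    rw [mem_closedBall_zero_iff]
    exact (norm_le_of_hasEigenvalue (hasEigenvalue_of_mem_nonzeroEigenvalues (hFr _)
      (Multiset.mem_filter.1 (hmem n i)).1)).trans (hP n).1.2)
  have hlim : ∀ i, Tendsto (fun n => a (ψ n) i) atTop (𝓝 (b i)) := fun i =>
    (tendsto_pi_nhds.1 hψb) i
  have hbρ : ∀ i, ρ ≤ ‖b i‖ := fun i =>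
    ge_of_tendsto' (hlim i).norm fun n => (Multiset.mem_filter.1 (hmem _ i)).2
  have hb0 : ∀ i, b i ≠ 0 := fun i => norm_pos_iff.1 (hρ.trans_le (hbρ i))
  have hle := sum_le_eigenvalueSum_of_tendsto p hL (F := fun n => F (φ (ψ n))) (fun n => hFr _)
    (hF.comp (hφ.comp hψ).tendsto_atTop) hb0 (a := fun n => a (ψ n))
    (fun n => by rw [ha]; exact Multiset.filter_le _ _) hψb
  have hsum : Tendsto (fun n => ∑ i, ‖a (ψ n) i‖ ^ p) atTop (𝓝 (∑ i, ‖b i‖ ^ p)) :=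
    tendsto_finsetSum _ fun i _ => (hlim i).norm.rpow_const (Or.inr hp.le)
  have hge : (eigenvalueSum p L).toReal + ε ≤ ∑ i, ‖b i‖ ^ p := by
    refine ge_of_tendsto' hsum fun n => ?_
    have h1 := (hP (ψ n)).2
    rw [← ha, Multiset.map_map] at h1
    exact (not_le.1 h1).le
  have hle2 : ∑ i, ‖b i‖ ^ p ≤ (eigenvalueSum p L).toReal := by
    have h1 := toReal_sum_map_enorm_rpow hp (Finset.univ.val.map b)
    rw [Multiset.map_map, Multiset.map_map] at h1
    change ∑ i, ‖b i‖ₑ ^ p = ENNReal.ofReal (∑ i, ‖b i‖ ^ p) at h1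
    rw [h1] at hle
    exact (ENNReal.ofReal_le_iff_le_toReal hfin).1 hle
  linarith

end EigenvalueSum

/-! ### Bounds and root-of-unity products for Weierstrass factors. -/

section WeierstrassFactor

/-- The Weierstrass factor `(1 - u) * exp (∑_{0 < k < m} u ^ k / k)`. -/
noncomputable def weierstrassFactor (m : ℕ) (u : ℂ) : ℂ :=
  (1 - u) * Complex.exp (∑ k ∈ Finset.Ico 1 m, (1 / (k : ℂ)) * u ^ k)

theorem weierstrassFactor_succ {m : ℕ} (hm : 1 ≤ m) (u : ℂ) :
    weierstrassFactor (m + 1) u = weierstrassFactor m u * Complex.exp ((1 / (m : ℂ)) * u ^ m) := by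
  rw [weierstrassFactor, weierstrassFactor, Finset.sum_Ico_succ_top hm, Complex.exp_add, mul_assoc]

/-- The exponent sum cancels the Taylor polynomial of `log (1 - u)`, so the factor is the
exponential of the remainder. -/
theorem norm_weierstrassFactor_le_of_norm_le_half {m : ℕ} (hm : 1 ≤ m) {u : ℂ}
    (hu : ‖u‖ ≤ 1 / 2) : ‖weierstrassFactor m u‖ ≤ Real.exp (2 * ‖u‖ ^ m) := by
  obtain ⟨n, rfl⟩ := Nat.exists_eq_add_of_le' hm
  have hu1 : ‖-u‖ < 1 := by rw [norm_neg]; linarith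
  have h1u : 1 + -u ≠ 0 := by
    intro h
    have : u = 1 := by linear_combination -h
    rw [this, norm_one] at hu
    norm_num at hu
  have h := Complex.norm_log_sub_logTaylor_le n hu1
  have hT : Complex.logTaylor (n + 1) (-u) =
      -∑ k ∈ Finset.Ico 1 (n + 1), (1 / (k : ℂ)) * u ^ k := by
    rw [Complex.logTaylor, Finset.sum_range_eq_add_Ico _ (Nat.succ_pos n),
      ← Finset.sum_neg_distrib]
    simp only [Nat.cast_zero, div_zero, zero_add]
    refine Finset.sum_congr rfl fun k _ => ?_
    rw [neg_pow u k, pow_succ, mul_neg_one, neg_mul, ← mul_assoc, ← pow_add, ← two_mul, pow_mul]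
    simp [div_eq_inv_mul]
  have hE : weierstrassFactor (n + 1) u =
      Complex.exp (Complex.log (1 + -u) - Complex.logTaylor (n + 1) (-u)) := by
    rw [hT, sub_neg_eq_add, Complex.exp_add, Complex.exp_log h1u, ← sub_eq_add_neg]
    rfl
  rw [hE]
  refine (Complex.norm_exp_le_exp_norm _).trans (Real.exp_le_exp.2 (h.trans ?_))
  rw [norm_neg]
  have h2 : (1 - ‖u‖)⁻¹ ≤ 2 := by
    rw [inv_le_comm₀ (by linarith) (by norm_num)]
    linarith
  calc ‖u‖ ^ (n + 1) * (1 - ‖u‖)⁻¹ / (n + 1) ≤ ‖u‖ ^ (n + 1) * 2 / 1 := by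
        gcongr
        linarith [(Nat.cast_nonneg n : (0 : ℝ) ≤ n)]
    _ = 2 * ‖u‖ ^ (n + 1) := by ring

theorem exists_norm_weierstrassFactor_le {p : ℝ} (hp : 0 < p) :
    ∃ Γ > 0, ∀ u : ℂ, ‖weierstrassFactor ⌈p⌉₊ u‖ ≤ Real.exp (Γ * ‖u‖ ^ p) := by
  -- For `‖u‖ > 1/2` the first term bounds `log ‖1 - u‖ ≤ log (3 ‖u‖) ≤ (3 ‖u‖)^p / p` and the
  -- second the exponent sum, where each `k < p`. The `2` serves `‖u‖ ≤ 1/2`, where `‖u‖^⌈p⌉ ≤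
  -- ‖u‖^p`.
  refine ⟨3 ^ p / p + ⌈p⌉₊ * 2 ^ p + 2, by positivity, fun u => ?_⟩
  have hm : 1 ≤ ⌈p⌉₊ := Nat.one_le_ceil_iff.2 hp
  have hx := norm_nonneg u
  set x := ‖u‖
  have hxp : 0 ≤ x ^ p := by positivity
  rcases le_or_gt x (1 / 2) with h | h
  · refine (norm_weierstrassFactor_le_of_norm_le_half hm h).trans (Real.exp_le_exp.2 ?_)
    have h1 : x ^ ⌈p⌉₊ ≤ x ^ p := by
      rcases hx.eq_or_lt with h0 | h0
      · rw [← h0, zero_pow (by omega), Real.zero_rpow hp.ne']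
      · rw [← Real.rpow_natCast]
        exact Real.rpow_le_rpow_of_exponent_ge h0 (by linarith) (Nat.le_ceil p)
    have h2 : 0 ≤ (3 ^ p / p + ⌈p⌉₊ * 2 ^ p) * x ^ p := by positivity
    linarith
  · have h1 : ‖(1 : ℂ) - u‖ ≤ Real.exp (3 ^ p / p * x ^ p) := by
      calc ‖(1 : ℂ) - u‖ ≤ 1 + x := by simpa using norm_sub_le (1 : ℂ) u
        _ ≤ 3 * x := by linarith
        _ = Real.exp (Real.log (3 * x)) := (Real.exp_log (by linarith)).symm
        _ ≤ Real.exp (3 ^ p / p * x ^ p) := by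
          rw [Real.exp_le_exp]
          refine (Real.log_le_rpow_div (by linarith) hp).trans ?_
          rw [Real.mul_rpow (by norm_num) hx]
          exact (by ring : (3 : ℝ) ^ p * x ^ p / p = 3 ^ p / p * x ^ p).le
    have h2 : ‖∑ k ∈ Finset.Ico 1 ⌈p⌉₊, (1 / (k : ℂ)) * u ^ k‖ ≤ ⌈p⌉₊ * 2 ^ p * x ^ p := by
      calc ‖∑ k ∈ Finset.Ico 1 ⌈p⌉₊, (1 / (k : ℂ)) * u ^ k‖
          ≤ ∑ k ∈ Finset.Ico 1 ⌈p⌉₊, 2 ^ p * x ^ p := by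
            refine norm_sum_le_of_le _ fun k hk => ?_
            rw [Finset.mem_Ico] at hk
            have hkp : (k : ℝ) ≤ p := (Nat.lt_ceil.1 hk.2).le
            have hk1 : (1 : ℝ) ≤ k := by exact_mod_cast hk.1
            rw [norm_mul, norm_pow, norm_div, norm_one, Complex.norm_natCast]
            calc 1 / (k : ℝ) * x ^ k ≤ 1 * x ^ k := by
                  gcongr
                  rw [div_le_one (by linarith)]
                  exact hk1
              _ ≤ 2 ^ k * x ^ k := by
                  gcongr
                  exact one_le_pow₀ (by norm_num)
              _ = (2 * x) ^ (k : ℝ) := by rw [Real.rpow_natCast, mul_pow]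
              _ ≤ (2 * x) ^ p := Real.rpow_le_rpow_of_exponent_le (by linarith) hkp
              _ = 2 ^ p * x ^ p := Real.mul_rpow (by norm_num) hx
        _ ≤ ⌈p⌉₊ * 2 ^ p * x ^ p := by
            rw [Finset.sum_const, nsmul_eq_mul, Nat.card_Ico, mul_assoc]
            gcongr
            exact Nat.sub_le _ _
    rw [weierstrassFactor, norm_mul]
    calc _ ≤ Real.exp (3 ^ p / p * x ^ p) * Real.exp (⌈p⌉₊ * 2 ^ p * x ^ p) := by
          gcongr
          exact (Complex.norm_exp_le_exp_norm _).trans (Real.exp_le_exp.2 h2)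
      _ ≤ _ := by
          rw [← Real.exp_add, Real.exp_le_exp]
          linarith

/-- Multiplication by a primitive root `ζ` permutes the roots and multiplies the sum by `ζ^k ≠ 1`.
-/
theorem sum_nthRootsFinset_pow_eq_zero {m k : ℕ} (hk : 0 < k) (hkm : k < m) :
    ∑ ω ∈ Polynomial.nthRootsFinset m (1 : ℂ), ω ^ k = 0 := by
  have hm : m ≠ 0 := by omega
  obtain hζ := Complex.isPrimitiveRoot_exp m hm
  set ζ := Complex.exp (2 * Real.pi * Complex.I / m)
  have hζ0 : ζ ≠ 0 := hζ.ne_zero hm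
  have h : ∑ ω ∈ Polynomial.nthRootsFinset m (1 : ℂ), ω ^ k =
      ∑ ω ∈ Polynomial.nthRootsFinset m (1 : ℂ), (ζ * ω) ^ k := by
    symm
    refine Finset.sum_nbij' (fun ω => ζ * ω) (fun ω => ζ⁻¹ * ω) ?_ ?_ ?_ ?_ ?_
    · intro ω hω
      rw [Polynomial.mem_nthRootsFinset (Nat.pos_of_ne_zero hm)] at hω ⊢
      rw [mul_pow, hζ.pow_eq_one, hω, mul_one]
    · intro ω hω
      rw [Polynomial.mem_nthRootsFinset (Nat.pos_of_ne_zero hm)] at hω ⊢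
      rw [mul_pow, inv_pow, hζ.pow_eq_one, hω, inv_one, mul_one]
    · intro ω _
      exact inv_mul_cancel_left₀ hζ0 ω
    · intro ω _
      exact mul_inv_cancel_left₀ hζ0 ω
    · intro ω _
      rfl
  simp_rw [mul_pow, ← Finset.mul_sum] at h
  have h1 := hζ.pow_ne_one_of_pos_of_lt hk.ne' hkm
  by_contra h0
  exact h1 (mul_right_cancel₀ h0 (by rw [one_mul]; exact h.symm))

/-- The exponents cancel because power sums of the roots of unity of order below `m` vanish. -/
theorem prod_weierstrassFactor_nthRootsFinset {m : ℕ} (hm : 0 < m) (u : ℂ) :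
    ∏ ω ∈ Polynomial.nthRootsFinset m (1 : ℂ), weierstrassFactor m (ω * u) = 1 - u ^ m := by
  have h1 := (Complex.isPrimitiveRoot_exp m hm.ne').pow_sub_pow_eq_prod_sub_mul (1 : ℂ) u hm
  simp only [weierstrassFactor]
  rw [Finset.prod_mul_distrib, ← h1, ← Complex.exp_sum, Finset.sum_comm]
  have h2 : ∑ k ∈ Finset.Ico 1 m, ∑ ω ∈ Polynomial.nthRootsFinset m (1 : ℂ),
      1 / (k : ℂ) * (ω * u) ^ k = 0 := by
    refine Finset.sum_eq_zero fun k hk => ?_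
    rw [Finset.mem_Ico] at hk
    simp_rw [mul_pow, mul_comm _ (u ^ k), ← mul_assoc, ← Finset.mul_sum]
    rw [sum_nthRootsFinset_pow_eq_zero hk.1 hk.2, mul_zero]
  rw [h2]
  simp

end WeierstrassFactor

/-! ### Estimates for holomorphic functions and polynomials. -/

section ComplexAnalysis

open Metric

/-- A Borel-Carathéodory bound for the linear coefficient of a zero-free product. -/
theorem norm_sum_le_of_norm_prod_le {ι : Type*} [Fintype ι] (a : ι → ℂ) {R M : ℝ} (hR : 0 < R)
    (hM : 0 < M) (ha : ∀ i, ‖a i‖ * R ≤ 2)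
    (hprod : ∀ w : ℂ, ‖w‖ = R → ‖∏ i, (1 - w * a i)‖ ≤ Real.exp M) :
    ‖∑ i, a i‖ ≤ 8 * M / R := by
  have hR2 : 0 < R / 2 := by positivity
  have hsmall : ∀ w ∈ ball (0 : ℂ) (R / 2), ∀ i, ‖w * a i‖ < 1 := by
    intro w hw i
    rw [mem_ball_zero_iff] at hw
    rw [norm_mul]
    rcases (norm_nonneg (a i)).eq_or_lt with h | h
    · rw [← h]; simp
    · calc ‖w‖ * ‖a i‖ < R / 2 * ‖a i‖ := by gcongr
        _ ≤ 1 := by linarith [ha i]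
  have hslit : ∀ w ∈ ball (0 : ℂ) (R / 2), ∀ i, 1 - w * a i ∈ Complex.slitPlane := by
    intro w hw i
    have := Complex.mem_slitPlane_of_norm_lt_one (z := -(w * a i)) (by
      rw [norm_neg]; exact hsmall w hw i)
    rwa [← sub_eq_add_neg] at this
  -- A logarithm of the product with `G 0 = 0` and `G' 0 = -∑ a i`. The maximum principle gives `Re
  -- G ≤ M`, Borel-Carathéodory gives `‖G‖ ≤ 2 M` on the circle of radius `R / 4`, and Cauchy's
  -- estimate there yields `8 M / R`.
  let G : ℂ → ℂ := fun w => ∑ i, Complex.log (1 - w * a i)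
  have hderiv : ∀ w ∈ ball (0 : ℂ) (R / 2),
      HasDerivAt G (∑ i, (-a i) / (1 - w * a i)) w := by
    intro w hw
    refine HasDerivAt.fun_sum fun i _ => ?_
    have h1 : HasDerivAt (fun w : ℂ => 1 - w * a i) (-a i) w := by
      simpa using ((hasDerivAt_id w).mul_const (a i)).const_sub 1
    exact h1.clog (hslit w hw i)
  have hdiff : DifferentiableOn ℂ G (ball 0 (R / 2)) := fun w hw =>
    (hderiv w hw).differentiableAt.differentiableWithinAt
  have hmax : ∀ w ∈ closedBall (0 : ℂ) R, ‖∏ i, (1 - w * a i)‖ ≤ Real.exp M := by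
    intro w hw
    refine Complex.norm_le_of_forall_mem_frontier_norm_le (f := fun w => ∏ i, (1 - w * a i))
      (U := ball (0 : ℂ) R) isBounded_ball (Differentiable.diffContOnCl (by fun_prop))
      (fun z hz => ?_) (by rwa [closure_ball _ hR.ne'])
    rw [frontier_ball _ hR.ne', mem_sphere_zero_iff_norm] at hz
    exact hprod z hz
  have hre : Set.MapsTo G (ball 0 (R / 2)) {z | z.re ≤ M} := by
    intro w hw
    have h1 : Complex.exp (G w) = ∏ i, (1 - w * a i) := by
      rw [Complex.exp_sum]
      exact Finset.prod_congr rfl fun i _ =>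
        Complex.exp_log (Complex.slitPlane_ne_zero (hslit w hw i))
    have h2 := hmax w (by
      rw [mem_closedBall_zero_iff]
      rw [mem_ball_zero_iff] at hw
      linarith)
    rw [← h1, Complex.norm_exp, Real.exp_le_exp] at h2
    exact h2
  have hbd : ∀ w ∈ sphere (0 : ℂ) (R / 4), ‖G w‖ ≤ 2 * M := by
    intro w hw
    rw [mem_sphere_zero_iff_norm] at hw
    have h1 := Complex.borelCaratheodory_zero hM hdiff hre hR2
      (z := w) (by rw [mem_ball_zero_iff, hw]; linarith) (by simp [G])
    rw [hw] at h1
    refine h1.trans (le_of_eq ?_)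
    field_simp
    norm_num
  have h1 := Complex.norm_deriv_le_of_forall_mem_sphere_norm_le (c := (0 : ℂ)) (f := G)
    (by positivity : 0 < R / 4)
    ((hdiff.mono (closedBall_subset_ball (by linarith))).diffContOnCl_ball subset_rfl) hbd
  rw [(hderiv 0 (mem_ball_self hR2)).deriv] at h1
  simp only [zero_mul, sub_zero, div_one, Finset.sum_neg_distrib, norm_neg] at h1
  refine h1.trans (le_of_eq ?_)
  field_simp
  norm_num

/-- Bernstein's argument: the maximum principle on the unit disc for the reversed polynomial `s^r
P(1/s)`. -/
theorem norm_eval_le_of_norm_eval_le {P : Polynomial ℂ} {r : ℕ} (hP : P.natDegree ≤ r) {M : ℝ}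
    (hM : ∀ t : ℂ, ‖t‖ ≤ 1 → ‖P.eval t‖ ≤ M) {t : ℂ} (ht : 1 ≤ ‖t‖) :
    ‖P.eval t‖ ≤ M * ‖t‖ ^ r := by
  have hrefl : ∀ s : ℂ, s ≠ 0 → (P.reflect r).eval s⁻¹ * s ^ r = P.eval s := by
    intro s hs
    have := invertibleOfNonzero hs
    have h := Polynomial.eval₂_reflect_mul_pow (RingHom.id ℂ) s r P hP
    simpa using h
  have ht0 : t ≠ 0 := norm_pos_iff.1 (by linarith)
  have h1 : ‖(P.reflect r).eval t⁻¹‖ ≤ M := by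
    refine Complex.norm_le_of_forall_mem_frontier_norm_le (f := fun w => (P.reflect r).eval w)
      (U := ball (0 : ℂ) 1) isBounded_ball (Differentiable.diffContOnCl (Polynomial.differentiable _))
      (fun z hz => ?_) ?_
    · rw [frontier_ball _ one_ne_zero, mem_sphere_zero_iff_norm] at hz
      have hz0 : z ≠ 0 := norm_pos_iff.1 (by rw [hz]; exact one_pos)
      have h2 := hrefl z⁻¹ (inv_ne_zero hz0)
      rw [inv_inv] at h2
      have h3 := hM z⁻¹ (by rw [norm_inv, hz, inv_one])
      rw [← h2, norm_mul, norm_pow, norm_inv, hz] at h3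
      simpa using h3
    · rw [closure_ball _ one_ne_zero, mem_closedBall_zero_iff, norm_inv]
      exact inv_le_one_of_one_le₀ ht
  rw [← hrefl t ht0, norm_mul, norm_pow]
  gcongr

/-- A bounded holomorphic function on a disc around `[-1/2, 1/2]` varies little between the ends. -/
theorem norm_sub_le_of_norm_le {f : ℂ → ℂ} (hf : Differentiable ℂ f) {r M : ℝ} (hr : 0 < r)
    (hM : ∀ z : ℂ, ‖z‖ ≤ 1 / 2 + r → ‖f z‖ ≤ M) : ‖f (1 / 2) - f (-(1 / 2))‖ ≤ M / r := by
  have hd : ∀ z ∈ closedBall (0 : ℂ) (1 / 2), ‖deriv f z‖ ≤ M / r := by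
    intro z hz
    rw [mem_closedBall_zero_iff] at hz
    refine Complex.norm_deriv_le_of_forall_mem_sphere_norm_le hr hf.diffContOnCl fun w hw => ?_
    refine hM w ?_
    rw [mem_sphere_iff_norm] at hw
    calc ‖w‖ = ‖z + (w - z)‖ := by ring_nf
      _ ≤ ‖z‖ + ‖w - z‖ := norm_add_le _ _
      _ ≤ _ := by rw [hw]; linarith
  have h := (convex_closedBall (0 : ℂ) (1 / 2)).norm_image_sub_le_of_norm_deriv_le
    (fun z _ => hf.differentiableAt) hd (x := -(1 / 2)) (y := 1 / 2) (by simp) (by simp)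
  have h1 : ‖(1 / 2 : ℂ) - -(1 / 2)‖ = 1 := by norm_num
  rwa [h1, mul_one] at h

end ComplexAnalysis

/-! ### The regularized determinant as a product, and growth constants. -/

section GrowthConstant

open Module

variable {X : Type u} [NormedAddCommGroup X] [NormedSpace ℂ X]

theorem sum_sum_map_eq {ι : Type*} (S : Finset ι) (f : ι → ℂ → ℂ) (s : Multiset ℂ) :
    ∑ k ∈ S, (s.map (f k)).sum = (s.map fun u => ∑ k ∈ S, f k u).sum := by
  induction s using Multiset.induction with
  | empty => simp
  | cons a s ih => simp [Finset.sum_add_distrib, ih]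

theorem regDet_eq_prod (p : ℝ) {F : X →L[ℂ] X} (hF : IsFiniteRank F) :
    regDet p F = ((nonzeroEigenvalues F).map (weierstrassFactor ⌈p⌉₊)).prod := by
  have h : ∀ k ∈ Finset.Ico 1 ⌈p⌉₊, 1 / (k : ℂ) * finTrace (F ^ k) =
      ((nonzeroEigenvalues F).map fun u => 1 / (k : ℂ) * u ^ k).sum := by
    intro k hk
    rw [finTrace_pow_eq_sum hF (Nat.one_le_iff_ne_zero.1 (Finset.mem_Ico.1 hk).1),
      Multiset.sum_map_mul_left]
  rw [regDet, detOneSub_eq_prod hF, Finset.sum_congr rfl h]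
  unfold weierstrassFactor
  rw [Multiset.prod_map_mul, sum_sum_map_eq, Complex.exp_multiset_sum, Multiset.map_map]
  rfl

theorem norm_prod_map_le_exp {g : ℂ → ℂ} {c : ℂ → ℝ} (s : Multiset ℂ)
    (h : ∀ u ∈ s, ‖g u‖ ≤ Real.exp (c u)) :
    ‖(s.map g).prod‖ ≤ Real.exp (s.map c).sum := by
  induction s using Multiset.induction with
  | empty => simp
  | cons a s ih =>
    rw [Multiset.map_cons, Multiset.prod_cons, Multiset.map_cons, Multiset.sum_cons, Real.exp_add,
      norm_mul]
    gcongr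
    · exact h a (Multiset.mem_cons_self _ _)
    · exact ih fun u hu => h u (Multiset.mem_cons_of_mem hu)

/-- A diagonal operator on `V`, padded with zeros and composed with a continuous projection onto
`V`. -/
theorem exists_isFiniteRank_nonzeroEigenvalues_eq (V : Submodule ℂ X) [FiniteDimensional ℂ V]
    (t : Multiset ℂ) (ht : ∀ μ ∈ t, μ ≠ 0) (hcard : t.card ≤ finrank ℂ V) :
    ∃ G : X →L[ℂ] X, IsFiniteRank G ∧ nonzeroEigenvalues G = t := by
  classical
  obtain ⟨d, hd⟩ := exists_fin_map_eq (t + Multiset.replicate (finrank ℂ V - t.card) 0)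
    (k := finrank ℂ V) (by simp; omega)
  obtain ⟨π, hπ⟩ := Submodule.ClosedComplemented.of_finiteDimensional V
  let D : V →ₗ[ℂ] V := Matrix.toLin (finBasis ℂ V) (finBasis ℂ V) (Matrix.diagonal d)
  let G : X →L[ℂ] X := V.subtypeL ∘L (LinearMap.toContinuousLinearMap D) ∘L π
  have hG : opRange G ≤ V := by
    rintro _ ⟨x, rfl⟩
    exact (D (π x)).2
  have hGD : restrictTo G V hG = D := by
    refine LinearMap.ext fun x => Subtype.ext ?_
    rw [coe_restrictTo_apply]
    simp [G, hπ]
  refine ⟨G, Submodule.finiteDimensional_of_le hG, ?_⟩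
  have hchar : D.charpoly.roots = Finset.univ.val.map d := by
    rw [← LinearMap.charpoly_toMatrix D (finBasis ℂ V), LinearMap.toMatrix_toLin,
      Matrix.charpoly_diagonal]
    have h := Polynomial.roots_multiset_prod_X_sub_C (Finset.univ.val.map d)
    rwa [Multiset.map_map] at h
  rw [nonzeroEigenvalues_eq hG, hGD, hchar, hd, Multiset.filter_add,
    Multiset.filter_eq_self.2 ht, Multiset.filter_eq_nil.2, add_zero]
  intro a ha
  simp [Multiset.eq_of_mem_replicate ha]

variable [CompleteSpace X]

theorem isGrowthConstant_of_norm_weierstrassFactor_le {p Γ : ℝ} (hp : 0 < p) (hΓ : 0 < Γ)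
    (h : ∀ u : ℂ, ‖weierstrassFactor ⌈p⌉₊ u‖ ≤ Real.exp (Γ * ‖u‖ ^ p)) :
    IsGrowthConstant X p Γ := by
  refine ⟨hΓ, fun F hF => ?_⟩
  rw [regDet_eq_prod p hF, toReal_eigenvalueSum hp hF, ← Multiset.sum_map_mul_left]
  exact norm_prod_map_le_exp _ fun u _ => h u

/-- A growth constant only speaks of complete spectra, but `t` is the complete nonzero spectrum of
another finite rank operator on `X`. Thus the same `Γ` serves for a part of the spectrum. -/
theorem IsGrowthConstant.norm_prod_le {p Γ : ℝ} (hp : 0 < p) (hΓ : IsGrowthConstant X p Γ)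
    {F : X →L[ℂ] X} (hF : IsFiniteRank F) {t : Multiset ℂ} (ht : t ≤ nonzeroEigenvalues F) :
    ‖(t.map (weierstrassFactor ⌈p⌉₊)).prod‖ ≤ Real.exp (Γ * (t.map fun μ => ‖μ‖ ^ p).sum) := by
  have : FiniteDimensional ℂ (opRange F) := hF
  obtain ⟨G, hG, rfl⟩ := exists_isFiniteRank_nonzeroEigenvalues_eq (opRange F) t
    (fun μ hμ => ne_zero_of_mem_nonzeroEigenvalues (Multiset.mem_of_le ht hμ))
    ((Multiset.card_le_card ht).trans (card_nonzeroEigenvalues_le hF))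
  rw [← regDet_eq_prod p hG, ← toReal_eigenvalueSum hp hG]
  exact hΓ.2 G hG

end GrowthConstant

/-! ### Quasi-norms and the Cauchy estimate along a line. -/

section QuasiNormLemmas

open Filter

theorem continuous_quasiNormTopology_iff {V : Type u} [AddCommGroup V] {N : V → ℝ} {D : V → ℂ} :
    Continuous[quasiNormTopology N, inferInstance] D ↔
      ∀ x, ∀ ε > 0, ∃ δ > 0, ∀ y, N (y - x) < δ → ‖D y - D x‖ < ε := by
  rw [@continuous_def _ _ (quasiNormTopology N) _]
  constructor
  · intro h x ε hε
    obtain ⟨δ, hδ, hδ'⟩ := h _ (Metric.isOpen_ball (x := D x) (ε := ε)) x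
      (Metric.mem_ball_self hε)
    exact ⟨δ, hδ, fun y hy => mem_ball_iff_norm.1 (hδ' y hy)⟩
  · intro h U hU x hx
    obtain ⟨ε, hε, hball⟩ := Metric.isOpen_iff.1 hU (D x) hx
    obtain ⟨δ, hδ, hδ'⟩ := h x ε hε
    exact ⟨δ, hδ, fun y hy => hball (mem_ball_iff_norm.2 (hδ' y hy))⟩

variable {V : Type u} [AddCommGroup V] [Module ℂ V] {N : V → ℝ} {q : ℝ}

theorem IsQuasiNorm.map_zero (hN : IsQuasiNorm N q) : N 0 = 0 := (hN.eq_zero_iff 0).2 rfl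

theorem IsQuasiNorm.map_neg (hN : IsQuasiNorm N q) (x : V) : N (-x) = N x := by
  have := hN.smul_eq (-1) x
  simpa using this

theorem IsQuasiNorm.map_sub_rev (hN : IsQuasiNorm N q) (x y : V) : N (x - y) = N (y - x) := by
  rw [← hN.map_neg, neg_sub]

theorem IsQuasiNorm.sub_le (hN : IsQuasiNorm N q) (x y : V) : N (x - y) ≤ q * (N x + N y) := by
  have := hN.add_le x (-y)
  rwa [hN.map_neg, ← sub_eq_add_neg] at this

theorem IsQuasiNorm.pos (hN : IsQuasiNorm N q) : 0 < q := one_pos.trans_le hN.one_le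

theorem IsQuasiNorm.le_of_sub (hN : IsQuasiNorm N q) (x y : V) :
    N x ≤ q * (N (x - y) + N y) := by
  simpa using hN.add_le (x - y) y

theorem IsQuasiNorm.sub_le_sub (hN : IsQuasiNorm N q) (x y z : V) :
    N (x - z) ≤ q * (N (x - y) + N (y - z)) := by
  simpa using hN.add_le (x - y) (y - z)

theorem IsQuasiNorm.exists_seq_of_dense (hN : IsQuasiNorm N q) {S : Set V}
    (hS : @Dense V (quasiNormTopology N) S) (x : V) :
    ∃ u : ℕ → V, (∀ n, u n ∈ S) ∧ Tendsto (fun n => N (u n - x)) atTop (𝓝 0) := by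
  have h : ∀ n : ℕ, ∃ y ∈ S, N (y - x) < 1 / ((n : ℝ) + 1) := by
    intro n
    have h1 : {y | N (y - x) < 1 / ((n : ℝ) + 1)} ∈ @nhds V (quasiNormTopology N) x :=
      (mem_nhds_quasiNormTopology hN x _).2 ⟨1 / ((n : ℝ) + 1), by positivity, fun y hy => hy⟩
    obtain ⟨y, hy, hyS⟩ := (@mem_closure_iff_nhds V (quasiNormTopology N) x S).1 (hS x) _ h1
    exact ⟨y, hyS, hy⟩
  choose u huS hu using h
  exact ⟨u, huS, squeeze_zero (fun n => hN.nonneg _) (fun n => (hu n).le)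
    tendsto_one_div_add_atTop_nhds_zero_nat⟩

/-- The difference estimate for functions of exponential type that are entire along a line. -/
theorem IsQuasiNorm.norm_sub_le_of_norm_le_exp (hN : IsQuasiNorm N q) {d : V → ℂ} {p c : ℝ}
    (hp : 0 < p) (hc : 0 ≤ c) (K L : V)
    (hd : Differentiable ℂ fun z : ℂ => d ((1 / 2 : ℂ) • (K + L) + z • (K - L)))
    (hbd : ∀ z : ℂ, ‖d ((1 / 2 : ℂ) • (K + L) + z • (K - L))‖ ≤
      Real.exp (c * N ((1 / 2 : ℂ) • (K + L) + z • (K - L)) ^ p)) :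
    ‖d K - d L‖ ≤ N (K - L) * Real.exp (q ^ (2 * p) * c * (N K + N L + 1) ^ p) := by
  have hq := hN.one_le
  have hK := hN.nonneg K
  have hL := hN.nonneg L
  rcases (hN.nonneg (K - L)).eq_or_lt with h0 | h0
  · have : K = L := sub_eq_zero.1 ((hN.eq_zero_iff _).1 h0.symm)
    simp [this, hN.map_zero]
  -- With radius `1 / N (K - L)` the factor `M / r` is the required one, while enlarging the disc
  -- adds only `1` to the quasi-norm. Two quasi-triangle inequalities cost `q ^ 2`, hence `q ^ (2 *
  -- p)` after raising to the power `p`.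
  · have key := norm_sub_le_of_norm_le hd (r := 1 / N (K - L))
      (M := Real.exp (q ^ (2 * p) * c * (N K + N L + 1) ^ p)) (by positivity) ?_
    · have e1 : (1 / 2 : ℂ) • (K + L) + (1 / 2 : ℂ) • (K - L) = K := by module
      have e2 : (1 / 2 : ℂ) • (K + L) + (-(1 / 2) : ℂ) • (K - L) = L := by module
      rw [e1, e2] at key
      refine key.trans (le_of_eq ?_)
      field_simp
    · intro z hz
      refine (hbd z).trans (Real.exp_le_exp.2 ?_)
      have h1 : N ((1 / 2 : ℂ) • (K + L) + z • (K - L)) ≤ q ^ 2 * (N K + N L + 1) := by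
        have a1 := hN.add_le ((1 / 2 : ℂ) • (K + L)) (z • (K - L))
        rw [hN.smul_eq, hN.smul_eq] at a1
        have a2 := hN.add_le K L
        have a3 := hN.sub_le K L
        have a4 : ‖(1 / 2 : ℂ)‖ = 1 / 2 := by norm_num
        have a5 : ‖z‖ * N (K - L) ≤ 1 / 2 * N (K - L) + 1 := by
          calc ‖z‖ * N (K - L) ≤ (1 / 2 + 1 / N (K - L)) * N (K - L) := by gcongr
            _ = _ := by field_simp
        rw [a4] at a1
        have a6 : N ((1 / 2 : ℂ) • (K + L) + z • (K - L)) ≤ q * (q * (N K + N L) + 1) :=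
          a1.trans (mul_le_mul_of_nonneg_left (by linarith) hN.pos.le)
        refine a6.trans ?_
        nlinarith [mul_nonneg (by linarith : 0 ≤ q) (by linarith : 0 ≤ q - 1)]
      have h2 : N ((1 / 2 : ℂ) • (K + L) + z • (K - L)) ^ p ≤
          q ^ (2 * p) * (N K + N L + 1) ^ p := by
        refine (Real.rpow_le_rpow (hN.nonneg _) h1 hp.le).trans (le_of_eq ?_)
        rw [Real.mul_rpow (by positivity) (by positivity), Real.rpow_mul hN.pos.le]
        norm_num
      calc c * N ((1 / 2 : ℂ) • (K + L) + z • (K - L)) ^ p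
          ≤ c * (q ^ (2 * p) * (N K + N L + 1) ^ p) := by gcongr
        _ = _ := by ring

end QuasiNormLemmas

/-! ### Extension from finite rank operators by density. -/

section Extension

open Filter

variable {X : Type u} [NormedAddCommGroup X] [NormedSpace ℂ X] {p : ℝ}
  {𝓘 : Submodule ℂ (X →L[ℂ] X)} {N : 𝓘 → ℝ} {q c : ℝ}

theorem norm_regDet_sub_le (hp : 0 < p) (hN : IsQuasiNorm N q) (hc : 0 ≤ c)
    (hbd : ∀ F : 𝓘, IsFiniteRank (F : X →L[ℂ] X) →
      ‖regDet p (F : X →L[ℂ] X)‖ ≤ Real.exp (c * N F ^ p))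
    {F G : 𝓘} (hF : IsFiniteRank (F : X →L[ℂ] X)) (hG : IsFiniteRank (G : X →L[ℂ] X)) :
    ‖regDet p (F : X →L[ℂ] X) - regDet p (G : X →L[ℂ] X)‖ ≤
      N (F - G) * Real.exp (q ^ (2 * p) * c * (N F + N G + 1) ^ p) := by
  have hA : IsFiniteRank ((1 / 2 : ℂ) • ((F : X →L[ℂ] X) + (G : X →L[ℂ] X))) := (hF.add hG).smul _
  have hB : IsFiniteRank ((F : X →L[ℂ] X) - (G : X →L[ℂ] X)) := hF.sub hG
  exact hN.norm_sub_le_of_norm_le_exp (d := fun T : 𝓘 => regDet p (T : X →L[ℂ] X)) hp hc F G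
    (differentiable_regDet_pencil p hA hB) fun z => hbd _ (hA.add (hB.smul z))

/-- `D` is the sequential limit of `det_p (I - F)` along finite rank operators `F`. -/
def IsDetLimit (p : ℝ) (𝓘 : Submodule ℂ (X →L[ℂ] X)) (N : 𝓘 → ℝ) (D : 𝓘 → ℂ) : Prop :=
  ∀ (L : 𝓘) (F : ℕ → 𝓘), (∀ n, IsFiniteRank (F n : X →L[ℂ] X)) →
    Tendsto (fun n => N (F n - L)) atTop (𝓝 0) →
      Tendsto (fun n => regDet p (F n : X →L[ℂ] X)) atTop (𝓝 (D L))

theorem IsContinuousDetExtension.isDetLimit {D : 𝓘 → ℂ}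
    (hD : IsContinuousDetExtension p 𝓘 N D) : IsDetLimit p 𝓘 N D := by
  intro L F hF hlim
  simp_rw [← hD.2 _ (hF _)]
  rw [Metric.tendsto_atTop']
  intro ε hε
  obtain ⟨δ, hδ, h⟩ := continuous_quasiNormTopology_iff.1 hD.1 L ε hε
  obtain ⟨n, hn⟩ := eventually_atTop.1 (hlim.eventually_lt_const hδ)
  exact ⟨n, fun m hm => by rw [dist_eq_norm]; exact h _ (hn m hm.le)⟩

/-- Local Lipschitz continuity of the limit of `det_p (I - F)`. -/
theorem IsDetLimit.exists_norm_sub_le (hp : 0 < p) (hN : IsQuasiNorm N q) (hc : 0 ≤ c)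
    (hbd : ∀ F : 𝓘, IsFiniteRank (F : X →L[ℂ] X) →
      ‖regDet p (F : X →L[ℂ] X)‖ ≤ Real.exp (c * N F ^ p))
    (hdense : @Dense 𝓘 (quasiNormTopology N) {L : 𝓘 | IsFiniteRank (L : X →L[ℂ] X)})
    {D : 𝓘 → ℂ} (hD : IsDetLimit p 𝓘 N D) (B : ℝ) :
    ∃ C > 0, ∀ K L : 𝓘, N K ≤ B → N L ≤ B → ‖D K - D L‖ ≤ C * N (K - L) := by
  have hq := hN.pos
  rcases lt_or_ge B 0 with hB0 | hB0
  · exact ⟨1, one_pos, fun K _ hK => absurd (hN.nonneg K) (not_le.2 (hK.trans_lt hB0))⟩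
  -- Approximants eventually have quasi-norm at most `q * (1 + B)`. The factor `q ^ 2` comes from
  -- passing from `F n - G n` to `K - L` through two quasi-triangle inequalities.
  refine ⟨Real.exp (q ^ (2 * p) * c * (q * (1 + B) + q * (1 + B) + 1) ^ p) * q ^ 2,
    by positivity, fun K L hK hL => ?_⟩
  obtain ⟨F, hF, hFK⟩ := hN.exists_seq_of_dense hdense K
  obtain ⟨G, hG, hGL⟩ := hN.exists_seq_of_dense hdense L
  have h1 : Tendsto (fun n => ‖regDet p (F n : X →L[ℂ] X) - regDet p (G n : X →L[ℂ] X)‖) atTop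
      (𝓝 ‖D K - D L‖) := ((hD K F hF hFK).sub (hD L G hG hGL)).norm
  have h2 : Tendsto (fun n => Real.exp (q ^ (2 * p) * c * (q * (1 + B) + q * (1 + B) + 1) ^ p) *
      (q * (N (F n - K) + q * (N (K - L) + N (G n - L))))) atTop
      (𝓝 (Real.exp (q ^ (2 * p) * c * (q * (1 + B) + q * (1 + B) + 1) ^ p) *
      (q * (0 + q * (N (K - L) + 0))))) :=
    ((hFK.add ((hGL.const_add _).const_mul q)).const_mul q).const_mul _
  have h3 := le_of_tendsto_of_tendsto h1 h2 ?_
  · refine h3.trans (le_of_eq ?_)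
    ring
  · filter_upwards [hFK.eventually_lt_const one_pos, hGL.eventually_lt_const one_pos]
      with n hFn hGn
    have b1 : N (F n) ≤ q * (1 + B) := (hN.le_of_sub (F n) K).trans (by gcongr)
    have b2 : N (G n) ≤ q * (1 + B) := (hN.le_of_sub (G n) L).trans (by gcongr)
    have b3 : N (F n - G n) ≤ q * (N (F n - K) + q * (N (K - L) + N (G n - L))) := by
      refine (hN.sub_le_sub (F n) K (G n)).trans ?_
      gcongr
      rw [hN.map_sub_rev (G n) L]
      exact hN.sub_le_sub K L (G n)
    have b4 := hN.nonneg (F n)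
    have b5 := hN.nonneg (G n)
    have b6 := hN.nonneg (F n - G n)
    refine (norm_regDet_sub_le hp hN hc hbd (hF n) (hG n)).trans ?_
    rw [mul_comm]
    gcongr

theorem IsDetLimit.isContinuousDetExtension (hp : 0 < p) (hN : IsQuasiNorm N q) (hc : 0 ≤ c)
    (hbd : ∀ F : 𝓘, IsFiniteRank (F : X →L[ℂ] X) →
      ‖regDet p (F : X →L[ℂ] X)‖ ≤ Real.exp (c * N F ^ p))
    (hdense : @Dense 𝓘 (quasiNormTopology N) {L : 𝓘 | IsFiniteRank (L : X →L[ℂ] X)})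
    {D : 𝓘 → ℂ} (hD : IsDetLimit p 𝓘 N D) : IsContinuousDetExtension p 𝓘 N D := by
  have hq := hN.one_le
  refine ⟨continuous_quasiNormTopology_iff.2 fun x ε hε => ?_, fun F hF => ?_⟩
  · obtain ⟨C, hC, h⟩ := hD.exists_norm_sub_le hp hN hc hbd hdense (q * (1 + N x))
    have hx := hN.nonneg x
    refine ⟨min 1 (ε / C), by positivity, fun y hy => ?_⟩
    obtain ⟨hy1, hy2⟩ := lt_min_iff.1 hy
    have b1 : N y ≤ q * (1 + N x) := (hN.le_of_sub y x).trans (by gcongr)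
    have b2 : N x ≤ q * (1 + N x) := by nlinarith
    calc ‖D y - D x‖ ≤ C * N (y - x) := h y x b1 b2
      _ < C * (ε / C) := by gcongr
      _ = ε := by field_simp
  · have h := hD F (fun _ => F) (fun _ => hF) (by simp [hN.map_zero])
    exact tendsto_nhds_unique h tendsto_const_nhds

theorem exists_isDetLimit (hp : 0 < p) (hN : IsQuasiNorm N q) (hc : 0 ≤ c)
    (hbd : ∀ F : 𝓘, IsFiniteRank (F : X →L[ℂ] X) →
      ‖regDet p (F : X →L[ℂ] X)‖ ≤ Real.exp (c * N F ^ p))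
    (hdense : @Dense 𝓘 (quasiNormTopology N) {L : 𝓘 | IsFiniteRank (L : X →L[ℂ] X)}) :
    ∃ D : 𝓘 → ℂ, IsDetLimit p 𝓘 N D := by
  have hq := hN.pos
  choose u hu hulim using hN.exists_seq_of_dense hdense
  -- Comparing two approximating sequences at independent indices gives both the Cauchy property (`F
  -- = G`) and independence of the choice of sequence.
  have hclose : ∀ (L : 𝓘) (F G : ℕ → 𝓘), (∀ n, IsFiniteRank (F n : X →L[ℂ] X)) →
      (∀ n, IsFiniteRank (G n : X →L[ℂ] X)) → Tendsto (fun n => N (F n - L)) atTop (𝓝 0) →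
      Tendsto (fun n => N (G n - L)) atTop (𝓝 0) → ∀ ε > 0, ∃ n₀, ∀ m ≥ n₀, ∀ n ≥ n₀,
        ‖regDet p (F m : X →L[ℂ] X) - regDet p (G n : X →L[ℂ] X)‖ < ε := by
    intro L F G hF hG hFL hGL ε hε
    have hL := hN.nonneg L
    set C := Real.exp (q ^ (2 * p) * c * (q * (1 + N L) + q * (1 + N L) + 1) ^ p) with hC
    have hCpos : 0 < C := Real.exp_pos _
    have hδ : 0 < min 1 (ε / (4 * q * C)) := by positivity
    obtain ⟨n₁, h₁⟩ := eventually_atTop.1 (hFL.eventually_lt_const hδ)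
    obtain ⟨n₂, h₂⟩ := eventually_atTop.1 (hGL.eventually_lt_const hδ)
    refine ⟨max n₁ n₂, fun m hm n hn => ?_⟩
    obtain ⟨f1, f2⟩ := lt_min_iff.1 (h₁ m (le_of_max_le_left hm))
    obtain ⟨g1, g2⟩ := lt_min_iff.1 (h₂ n (le_of_max_le_right hn))
    have b1 : N (F m) ≤ q * (1 + N L) := (hN.le_of_sub (F m) L).trans (by gcongr)
    have b2 : N (G n) ≤ q * (1 + N L) := (hN.le_of_sub (G n) L).trans (by gcongr)
    have b3 : N (F m - G n) ≤ q * (ε / (4 * q * C) + ε / (4 * q * C)) := by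
      refine (hN.sub_le_sub (F m) L (G n)).trans ?_
      rw [hN.map_sub_rev L (G n)]
      gcongr
    have b4 := hN.nonneg (F m)
    have b5 := hN.nonneg (G n)
    calc ‖regDet p (F m : X →L[ℂ] X) - regDet p (G n : X →L[ℂ] X)‖
        ≤ N (F m - G n) * Real.exp (q ^ (2 * p) * c * (N (F m) + N (G n) + 1) ^ p) :=
          norm_regDet_sub_le hp hN hc hbd (hF m) (hG n)
      _ ≤ q * (ε / (4 * q * C) + ε / (4 * q * C)) * C := by
          rw [hC]
          gcongr
      _ = ε / 2 := by field_simp; norm_num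
      _ < ε := half_lt_self hε
  have hcauchy : ∀ L, ∃ l : ℂ, Tendsto (fun n => regDet p (u L n : X →L[ℂ] X)) atTop (𝓝 l) := by
    intro L
    refine cauchySeq_tendsto_of_complete (Metric.cauchySeq_iff.2 fun ε hε => ?_)
    obtain ⟨n₀, h⟩ := hclose L (u L) (u L) (hu L) (hu L) (hulim L) (hulim L) ε hε
    exact ⟨n₀, fun m hm n hn => by rw [dist_eq_norm]; exact h m hm n hn⟩
  choose D hD using hcauchy
  refine ⟨D, fun L F hF hFL => ?_⟩
  have h0 : Tendsto (fun n => regDet p (F n : X →L[ℂ] X) - regDet p (u L n : X →L[ℂ] X)) atTop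
      (𝓝 0) := by
    rw [Metric.tendsto_atTop]
    intro ε hε
    obtain ⟨n₀, h⟩ := hclose L F (u L) hF (hu L) hFL (hulim L) ε hε
    exact ⟨n₀, fun n hn => by rw [dist_zero_right]; exact h n hn n hn⟩
  simpa using h0.add (hD L)

theorem IsDetLimit.unique (hN : IsQuasiNorm N q)
    (hdense : @Dense 𝓘 (quasiNormTopology N) {L : 𝓘 | IsFiniteRank (L : X →L[ℂ] X)})
    {D D' : 𝓘 → ℂ} (hD : IsDetLimit p 𝓘 N D) (hD' : IsDetLimit p 𝓘 N D') : D = D' := by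
  funext L
  obtain ⟨F, hF, hFL⟩ := hN.exists_seq_of_dense hdense L
  exact tendsto_nhds_unique (hD L F hF hFL) (hD' L F hF hFL)

theorem IsDetLimit.differentiable (hp : 0 < p) (hN : IsQuasiNorm N q) (hc : 0 ≤ c)
    (hbd : ∀ F : 𝓘, IsFiniteRank (F : X →L[ℂ] X) →
      ‖regDet p (F : X →L[ℂ] X)‖ ≤ Real.exp (c * N F ^ p))
    (hdense : @Dense 𝓘 (quasiNormTopology N) {L : 𝓘 | IsFiniteRank (L : X →L[ℂ] X)})
    {D : 𝓘 → ℂ} (hD : IsDetLimit p 𝓘 N D) (K L : 𝓘) :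
    Differentiable ℂ fun z : ℂ => D (K + z • L) := by
  have hq := hN.one_le
  have hext := hD.isContinuousDetExtension hp hN hc hbd hdense
  obtain ⟨F, hF, hFK⟩ := hN.exists_seq_of_dense hdense K
  obtain ⟨G, hG, hGL⟩ := hN.exists_seq_of_dense hdense L
  have hK := hN.nonneg K
  have hL := hN.nonneg L
  -- The Lipschitz bound makes `D` along the lines `F n + z • G n` converge locally uniformly; there
  -- `D` is `regDet`, which is entire in `z`.
  have hmain : TendstoLocallyUniformlyOn (fun n (z : ℂ) => D (F n + z • G n))
      (fun z => D (K + z • L)) atTop Set.univ := by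
    rw [Metric.tendstoLocallyUniformlyOn_iff]
    intro ε hε z₀ _
    set r := ‖z₀‖ + 1
    have hr : 0 < r := by positivity
    obtain ⟨C, hC, h⟩ := hD.exists_norm_sub_le hp hN hc hbd hdense
      (q * (q * (1 + N K) + r * (q * (1 + N L))))
    refine ⟨Metric.ball z₀ 1, mem_nhdsWithin_of_mem_nhds (Metric.ball_mem_nhds _ one_pos), ?_⟩
    have hlim : Tendsto (fun n => C * (q * (N (F n - K) + r * N (G n - L)))) atTop (𝓝 0) := by
      simpa using ((hFK.add (hGL.const_mul r)).const_mul q).const_mul C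
    filter_upwards [hlim.eventually_lt_const hε, hFK.eventually_lt_const one_pos,
      hGL.eventually_lt_const one_pos] with n hn hFn hGn z hz
    have hzr : ‖z‖ ≤ r := by
      rw [mem_ball_iff_norm] at hz
      calc ‖z‖ = ‖z₀ + (z - z₀)‖ := by ring_nf
        _ ≤ ‖z₀‖ + ‖z - z₀‖ := norm_add_le _ _
        _ ≤ r := by linarith
    have b1 : N (F n) ≤ q * (1 + N K) := (hN.le_of_sub (F n) K).trans (by gcongr)
    have b2 : N (G n) ≤ q * (1 + N L) := (hN.le_of_sub (G n) L).trans (by gcongr)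
    have b3 : N (F n + z • G n) ≤ q * (q * (1 + N K) + r * (q * (1 + N L))) := by
      refine (hN.add_le _ _).trans ?_
      rw [hN.smul_eq]
      have := hN.nonneg (G n)
      gcongr
    have b4 : N (K + z • L) ≤ q * (q * (1 + N K) + r * (q * (1 + N L))) := by
      refine (hN.add_le _ _).trans ?_
      rw [hN.smul_eq]
      gcongr <;> nlinarith
    have b5 : N (F n + z • G n - (K + z • L)) ≤ q * (N (F n - K) + r * N (G n - L)) := by
      have h1 := hN.add_le (F n - K) (z • (G n - L))
      rw [hN.smul_eq] at h1
      have h2 : F n + z • G n - (K + z • L) = F n - K + z • (G n - L) := by module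
      rw [h2]
      refine h1.trans ?_
      have := hN.nonneg (G n - L)
      gcongr
    rw [dist_comm, dist_eq_norm]
    calc _ ≤ C * N (F n + z • G n - (K + z • L)) := h _ _ b3 b4
      _ ≤ C * (q * (N (F n - K) + r * N (G n - L))) := by gcongr
      _ < ε := hn
  rw [← differentiableOn_univ]
  refine hmain.differentiableOn (Eventually.of_forall fun n => ?_) isOpen_univ
  have h1 : (fun z : ℂ => D (F n + z • G n)) =
      fun z : ℂ => regDet p ((F n : X →L[ℂ] X) + z • (G n : X →L[ℂ] X)) := by
    funext z
    exact hext.2 _ ((hF n).add ((hG n).smul z))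
  rw [h1]
  exact (differentiable_regDet_pencil p (hF n) (hG n)).differentiableOn

end Extension

/-! ### Scalar multiples and finite rank perturbations. -/

section Scaling

open Module

variable {X : Type u} [NormedAddCommGroup X] [NormedSpace ℂ X]

theorem genEigenspaceOf_smul {z : ℂ} (hz : z ≠ 0) (F : X →L[ℂ] X) (μ : ℂ) :
    genEigenspaceOf (z • F) (z * μ) = genEigenspaceOf F μ := by
  ext x
  have h : (((z • F : X →L[ℂ] X) : X →ₗ[ℂ] X) - (z * μ) • (1 : End ℂ X)) =
      z • ((F : X →ₗ[ℂ] X) - μ • (1 : End ℂ X)) := by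
    ext y
    simp [smul_sub, mul_smul]
  rw [genEigenspaceOf, genEigenspaceOf, End.mem_maxGenEigenspace, End.mem_maxGenEigenspace, h]
  refine exists_congr fun k => ?_
  rw [smul_pow, LinearMap.smul_apply, smul_eq_zero_iff_right (pow_ne_zero _ hz)]

theorem nonzeroEigenvalues_smul {z : ℂ} (hz : z ≠ 0) {F : X →L[ℂ] X} (hF : IsFiniteRank F) :
    nonzeroEigenvalues (z • F) = (nonzeroEigenvalues F).map (z * ·) := by
  ext μ
  obtain ⟨ν, rfl⟩ : ∃ ν, μ = z * ν := ⟨z⁻¹ * μ, by field_simp⟩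
  rw [Multiset.count_map_eq_count' _ _ (mul_right_injective₀ hz)]
  rcases eq_or_ne ν 0 with rfl | hν
  · rw [mul_zero, Multiset.count_eq_zero_of_notMem fun h => ne_zero_of_mem_nonzeroEigenvalues h rfl,
      Multiset.count_eq_zero_of_notMem fun h => ne_zero_of_mem_nonzeroEigenvalues h rfl]
  · rw [count_nonzeroEigenvalues (hF.smul z) (mul_ne_zero hz hν), count_nonzeroEigenvalues hF hν,
      genEigenspaceOf_smul hz]

theorem prod_regDet_nthRoots_smul {p : ℝ} (hp : 0 < p) {z : ℂ} (hz : z ≠ 0) {F : X →L[ℂ] X}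
    (hF : IsFiniteRank F) :
    ∏ ω ∈ Polynomial.nthRootsFinset ⌈p⌉₊ (1 : ℂ), regDet p ((ω * z) • F) =
      ((nonzeroEigenvalues F).map fun μ => 1 - z ^ ⌈p⌉₊ * μ ^ ⌈p⌉₊).prod := by
  have hm : 0 < ⌈p⌉₊ := Nat.ceil_pos.2 hp
  have h : ∀ ω ∈ Polynomial.nthRootsFinset ⌈p⌉₊ (1 : ℂ), regDet p ((ω * z) • F) =
      ((nonzeroEigenvalues F).map fun μ => weierstrassFactor ⌈p⌉₊ (ω * (z * μ))).prod := by
    intro ω hω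
    rw [Polynomial.mem_nthRootsFinset hm] at hω
    have hω0 : ω ≠ 0 := by
      rintro rfl
      rw [zero_pow hm.ne'] at hω
      exact zero_ne_one hω
    rw [regDet_eq_prod p (hF.smul _), nonzeroEigenvalues_smul (mul_ne_zero hω0 hz) hF,
      Multiset.map_map]
    simp only [Function.comp_def, mul_assoc]
  rw [Finset.prod_congr rfl h, ← Multiset.prod_map_prod]
  simp_rw [prod_weierstrassFactor_nthRootsFinset hm, mul_pow]

/-- Telescoping `A^(k+1) - B^(k+1) = A (A^k - B^k) + (A - B) B^k` adds at most `r` to the rank at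
each step. -/
theorem finrank_opRange_pow_sub_pow_le {A B : X →L[ℂ] X} (hA : IsFiniteRank A)
    (hB : IsFiniteRank B) {r : ℕ} (hr : finrank ℂ (opRange (A - B)) ≤ r) (k : ℕ) :
    IsFiniteRank (A ^ k - B ^ k) ∧ finrank ℂ (opRange (A ^ k - B ^ k)) ≤ k * r := by
  induction k with
  | zero =>
    have : opRange (A ^ 0 - B ^ 0) = ⊥ := by simp [opRange]
    unfold IsFiniteRank
    rw [this]
    exact ⟨inferInstance, by simp⟩
  | succ k ih =>
    have h : A ^ (k + 1) - B ^ (k + 1) = A * (A ^ k - B ^ k) + (A - B) * B ^ k := by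
      rw [pow_succ', pow_succ']
      noncomm_ring
    have h1 := ih.1.mul_left A
    have h2 := (hA.sub hB).mul_right (B ^ k)
    have : FiniteDimensional ℂ (opRange (A ^ k - B ^ k)) := ih.1
    have : FiniteDimensional ℂ (opRange (A * (A ^ k - B ^ k))) := h1
    have : FiniteDimensional ℂ (opRange ((A - B) * B ^ k)) := h2
    have : FiniteDimensional ℂ (opRange (A - B)) := hA.sub hB
    rw [h]
    refine ⟨h1.add h2, ?_⟩
    calc finrank ℂ (opRange (A * (A ^ k - B ^ k) + (A - B) * B ^ k))
        ≤ finrank ℂ ↥(opRange (A * (A ^ k - B ^ k)) ⊔ opRange ((A - B) * B ^ k)) :=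
          Submodule.finrank_mono (opRange_add_le _ _)
      _ ≤ finrank ℂ (opRange (A * (A ^ k - B ^ k))) + finrank ℂ (opRange ((A - B) * B ^ k)) :=
          Submodule.finrank_add_le_finrank_add_finrank _ _
      _ ≤ k * r + r := by
          refine add_le_add ?_ ((Submodule.finrank_mono (opRange_mul_le _ _)).trans hr)
          rw [opRange_mul_eq_map]
          exact (Submodule.finrank_map_le _ _).trans ih.2
      _ = (k + 1) * r := by ring

theorem norm_finTrace_pow_sub_le {A B : X →L[ℂ] X} (hA : IsFiniteRank A)
    (hB : IsFiniteRank B) {r : ℕ} (hr : finrank ℂ (opRange (A - B)) ≤ r) {M : ℝ} (hAM : ‖A‖ ≤ M)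
    (hBM : ‖B‖ ≤ M) {k : ℕ} (hk : k ≠ 0) :
    ‖finTrace (A ^ k) - finTrace (B ^ k)‖ ≤ k * (2 * r * M ^ k) := by
  obtain ⟨h1, h2⟩ := finrank_opRange_pow_sub_pow_le hA hB hr k
  have h3 : finTrace (A ^ k) - finTrace (B ^ k) = finTrace (A ^ k - B ^ k) := by
    have := finTrace_add h1 (hB.pow hk)
    rw [sub_add_cancel] at this
    rw [this, add_sub_cancel_right]
  rw [h3]
  have h4 : ‖A ^ k - B ^ k‖ ≤ 2 * M ^ k := by
    calc ‖A ^ k - B ^ k‖ ≤ ‖A ^ k‖ + ‖B ^ k‖ := norm_sub_le _ _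
      _ ≤ ‖A‖ ^ k + ‖B‖ ^ k :=
        add_le_add (norm_pow_le' _ (Nat.pos_of_ne_zero hk)) (norm_pow_le' _ (Nat.pos_of_ne_zero hk))
      _ ≤ M ^ k + M ^ k := by gcongr
      _ = 2 * M ^ k := by ring
  calc ‖finTrace (A ^ k - B ^ k)‖ ≤ ((k * r : ℕ) : ℝ) * ‖A ^ k - B ^ k‖ := norm_finTrace_le h1 h2
    _ ≤ ((k * r : ℕ) : ℝ) * (2 * M ^ k) := by gcongr
    _ = _ := by push_cast; ring

/-- A finite rank perturbation changes the growth of `det_p` only in lower order. -/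
theorem norm_regDet_le_of_finiteRank_perturbation {p : ℝ} {E G : X →L[ℂ] X} (hE : IsFiniteRank E)
    (hG : IsFiniteRank G) {r : ℕ} (hr : finrank ℂ (opRange G) ≤ r) {b T : ℝ} (hb : ‖E‖ + ‖G‖ ≤ b)
    (hb1 : 1 ≤ b) {z : ℂ} (hz : 1 ≤ ‖z‖)
    (hT : ∀ t : ℂ, ‖t‖ ≤ 1 → ‖regDet p (z • E + t • G)‖ ≤ Real.exp T) :
    ‖regDet p (z • E + z • G)‖ ≤
      Real.exp (T + 2 * (⌈p⌉₊ * (2 * r * (‖z‖ * b) ^ (⌈p⌉₊ - 1)))) * ‖z‖ ^ r := by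
  have hzE := hE.smul z
  obtain ⟨P, hP, hPeval⟩ := exists_polynomial_detOneSub hzE hG
  set U := ⌈p⌉₊ * (2 * r * (‖z‖ * b) ^ (⌈p⌉₊ - 1)) with hU
  let S : ℂ → ℂ := fun t => ∑ k ∈ Finset.Ico 1 ⌈p⌉₊, (1 / (k : ℂ)) * finTrace ((z • E + t • G) ^ k)
  have hreg : ∀ t, regDet p (z • E + t • G) = P.eval t * Complex.exp (S t) := by
    intro t
    rw [regDet, hPeval]
  have hM1 : 1 ≤ ‖z‖ * b := by nlinarith
  -- Only traces of powers `k ≤ ⌈p⌉ - 1` occur and `t • G` has rank at most `r`, so the exponent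
  -- moves by a quantity of order `‖z‖ ^ (⌈p⌉ - 1)`.
  have hS : ∀ t : ℂ, ‖t‖ ≤ ‖z‖ → ‖S t - S 0‖ ≤ U := by
    intro t ht
    rw [← Finset.sum_sub_distrib]
    calc _ ≤ ∑ k ∈ Finset.Ico 1 ⌈p⌉₊, 2 * r * (‖z‖ * b) ^ (⌈p⌉₊ - 1) := by
          refine norm_sum_le_of_le _ fun k hk => ?_
          rw [Finset.mem_Ico] at hk
          have hk0 : (0 : ℝ) < k := by exact_mod_cast hk.1
          have h1 : ‖z • E + t • G‖ ≤ ‖z‖ * b := by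
            calc ‖z • E + t • G‖ ≤ ‖z • E‖ + ‖t • G‖ := norm_add_le _ _
              _ = ‖z‖ * ‖E‖ + ‖t‖ * ‖G‖ := by rw [norm_smul, norm_smul]
              _ ≤ ‖z‖ * ‖E‖ + ‖z‖ * ‖G‖ := by gcongr
              _ = ‖z‖ * (‖E‖ + ‖G‖) := by ring
              _ ≤ ‖z‖ * b := by gcongr
          have h2 : ‖z • E + (0 : ℂ) • G‖ ≤ ‖z‖ * b := by
            rw [zero_smul, add_zero, norm_smul]
            gcongr
            linarith [norm_nonneg G]
          have h3 : finrank ℂ (opRange (z • E + t • G - (z • E + (0 : ℂ) • G))) ≤ r := by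
            have : z • E + t • G - (z • E + (0 : ℂ) • G) = t • G := by module
            rw [this]
            have : FiniteDimensional ℂ (opRange G) := hG
            exact (Submodule.finrank_mono (opRange_smul_le t G)).trans hr
          have h4 := norm_finTrace_pow_sub_le (hzE.add (hG.smul t)) (hzE.add (hG.smul 0)) h3 h1 h2
            (Nat.one_le_iff_ne_zero.1 hk.1)
          rw [← mul_sub, norm_mul, norm_div, norm_one, Complex.norm_natCast]
          calc _ ≤ 1 / (k : ℝ) * (k * (2 * r * (‖z‖ * b) ^ k)) := by gcongr
            _ = 2 * r * (‖z‖ * b) ^ k := by field_simp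
            _ ≤ 2 * r * (‖z‖ * b) ^ (⌈p⌉₊ - 1) := by
              gcongr
              omega
      _ ≤ U := by
          rw [Finset.sum_const, nsmul_eq_mul, Nat.card_Ico, hU]
          gcongr
          exact Nat.sub_le _ _
  -- Freezing the exponential at `t = 0` leaves a polynomial of degree at most `r` in `t`. Its bound
  -- on the unit disc extends to `t = z` at the cost of `‖z‖ ^ r`; restoring the exponential costs a
  -- second `U`.
  have hbound : ∀ t : ℂ, ‖t‖ ≤ 1 →
      ‖(P * Polynomial.C (Complex.exp (S 0))).eval t‖ ≤ Real.exp (T + U) := by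
    intro t ht
    have h1 : (P * Polynomial.C (Complex.exp (S 0))).eval t =
        regDet p (z • E + t • G) * Complex.exp (-(S t - S 0)) := by
      rw [hreg, mul_assoc, ← Complex.exp_add]
      simp
    rw [h1, norm_mul, Real.exp_add]
    gcongr
    · exact hT t ht
    · refine (Complex.norm_exp_le_exp_norm _).trans (Real.exp_le_exp.2 ?_)
      rw [norm_neg]
      exact hS t (ht.trans hz)
  have hdeg : (P * Polynomial.C (Complex.exp (S 0))).natDegree ≤ r :=
    (Polynomial.natDegree_mul_C_le _ _).trans (hP.trans hr)
  have h2 := norm_eval_le_of_norm_eval_le hdeg hbound hz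
  have h3 : regDet p (z • E + z • G) =
      (P * Polynomial.C (Complex.exp (S 0))).eval z * Complex.exp (S z - S 0) := by
    rw [hreg, Polynomial.eval_mul, Polynomial.eval_C, mul_assoc, ← Complex.exp_add]
    simp
  rw [h3, norm_mul]
  calc _ ≤ Real.exp (T + U) * ‖z‖ ^ r * Real.exp U := by
        gcongr
        exact (Complex.norm_exp_le_exp_norm _).trans (Real.exp_le_exp.2 (hS z le_rfl))
    _ = Real.exp (T + 2 * U) * ‖z‖ ^ r := by
        rw [two_mul, ← add_assoc, Real.exp_add (T + U)]
        ring

end Scaling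

/-! ### Minimal type and small eigenvalues for integral `p`. -/

section Growth

open Filter

theorem eventually_lower_order_le {m : ℕ} (hm : 1 ≤ m) {η : ℝ} (hη : 0 < η) (C : ℝ) (r : ℕ) :
    ∀ᶠ x : ℝ in atTop, C * x ^ (m - 1) + r * Real.log x ≤ η * x ^ m := by
  have h1 := (Real.isLittleO_log_id_atTop.bound (c := η / (2 * (r + 1))) (by positivity))
  filter_upwards [h1, eventually_ge_atTop 1, eventually_ge_atTop (2 * C / η)] with x hx hx1 hxC
  have hx0 : 0 < x := by linarith
  have e1 : x ^ m = x * x ^ (m - 1) := by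
    rw [← pow_succ', Nat.sub_add_cancel hm]
  have e2 : x ≤ x ^ m := by
    rw [e1]
    exact le_mul_of_one_le_right hx0.le (one_le_pow₀ hx1)
  have b1 : C * x ^ (m - 1) ≤ η / 2 * x ^ m := by
    rw [e1, ← mul_assoc]
    gcongr
    rw [div_le_iff₀ hη] at hxC
    linarith
  have b2 : r * Real.log x ≤ η / 2 * x ^ m := by
    have hl : Real.log x ≤ η / (2 * (r + 1)) * x := by
      have := (le_abs_self _).trans hx
      simpa [abs_of_pos hx0] using this
    calc r * Real.log x ≤ (r + 1) * Real.log x := by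
          have := Real.log_nonneg hx1
          nlinarith
      _ ≤ (r + 1) * (η / (2 * (r + 1)) * x) := by gcongr
      _ = η / 2 * x := by field_simp
      _ ≤ _ := by gcongr
  linarith

variable {X : Type u} [NormedAddCommGroup X] [NormedSpace ℂ X] {p : ℝ}
  {𝓘 : Submodule ℂ (X →L[ℂ] X)} {N : 𝓘 → ℝ} {q c : ℝ}

/-- Along a convergent sequence of finite rank operators, `z ↦ det_p (I - z F)` is uniformly of
minimal type with respect to the order `p`, if `p` is an integer. -/
theorem exists_forall_norm_regDet_smul_le (hp : 0 < p) (hpm : (⌈p⌉₊ : ℝ) = p)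
    (hN : IsQuasiNorm N q) (hc : 0 ≤ c) (hop : ∀ L : 𝓘, ‖(L : X →L[ℂ] X)‖ ≤ N L)
    (hbd : ∀ F : 𝓘, IsFiniteRank (F : X →L[ℂ] X) →
      ‖regDet p (F : X →L[ℂ] X)‖ ≤ Real.exp (c * N F ^ p))
    {L : 𝓘} {F : ℕ → 𝓘} (hF : ∀ n, IsFiniteRank (F n : X →L[ℂ] X))
    (hlim : Tendsto (fun n => N (F n - L)) atTop (𝓝 0)) {η : ℝ} (hη : 0 < η) :
    ∃ R₀ ≥ 1, ∀ᶠ n in atTop, ∀ z : ℂ, R₀ ≤ ‖z‖ →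
      ‖regDet p (z • (F n : X →L[ℂ] X))‖ ≤ Real.exp (η * ‖z‖ ^ ⌈p⌉₊) := by
  have hq := hN.pos
  set m := ⌈p⌉₊ with hmdef
  have hm : 1 ≤ m := Nat.one_le_ceil_iff.2 hp
  -- `δ` bounds the quasi-norm of `F n - F₀`, where `F₀` is a fixed late member of the sequence. Its
  -- rank does not depend on `n`, which makes `R₀` uniform.
  obtain ⟨δ, hδ, hδη⟩ : ∃ δ > 0, c * (q * (2 * δ)) ^ m ≤ η / 2 := by
    have h1 : Tendsto (fun δ : ℝ => c * (q * (2 * δ)) ^ m) (𝓝[>] 0) (𝓝 0) := by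
      have h2 : Continuous fun δ : ℝ => c * (q * (2 * δ)) ^ m := by fun_prop
      have h3 := h2.tendsto 0
      simp only [mul_zero, zero_pow (Nat.one_le_iff_ne_zero.1 hm)] at h3
      exact h3.mono_left nhdsWithin_le_nhds
    obtain ⟨δ, h2, h3⟩ := ((h1.eventually_le_const (half_pos hη)).and self_mem_nhdsWithin).exists
    exact ⟨δ, h3, h2⟩
  have hδ' : 0 < δ / (2 * q) := by positivity
  obtain ⟨n₀, hn₀⟩ := eventually_atTop.1 (hlim.eventually_le_const hδ')
  set F₀ := F n₀
  set r := Module.finrank ℂ (opRange (F₀ : X →L[ℂ] X))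
  set a := N F₀
  have ha : 0 ≤ a := hN.nonneg _
  set b := δ + a + 1
  have hb : 0 < b := by positivity
  obtain ⟨R₁, hR₁⟩ := eventually_atTop.1
    (eventually_lower_order_le hm (half_pos hη) (2 * (m * (2 * r * b ^ (m - 1)))) r)
  -- Beyond `a / δ` the term `t • F₀` with `‖t‖ ≤ 1` has quasi-norm at most `δ ‖z‖`. Beyond `R₁` the
  -- cost of moving `t` from the unit disc to `z` is of lower order.
  refine ⟨max (max R₁ 1) (a / δ), le_max_of_le_left (le_max_right _ _), ?_⟩
  filter_upwards [eventually_ge_atTop n₀] with n hn z hz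
  have hz1 : 1 ≤ ‖z‖ := (le_max_right _ _).trans ((le_max_left _ _).trans hz)
  have hzR : R₁ ≤ ‖z‖ := (le_max_left _ _).trans ((le_max_left _ _).trans hz)
  have hza : a ≤ ‖z‖ * δ := by
    rw [← div_le_iff₀ hδ]
    exact (le_max_right _ _).trans hz
  have hE : N (F n - F₀) ≤ δ := by
    refine (hN.sub_le_sub (F n) L F₀).trans ?_
    rw [hN.map_sub_rev L F₀]
    calc q * (N (F n - L) + N (F₀ - L)) ≤ q * (δ / (2 * q) + δ / (2 * q)) := by
          gcongr
          · exact hn₀ n hn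
          · exact hn₀ n₀ le_rfl
      _ = δ := by field_simp; norm_num
  have hT : ∀ t : ℂ, ‖t‖ ≤ 1 →
      ‖regDet p (z • ((F n - F₀ : 𝓘) : X →L[ℂ] X) + t • (F₀ : X →L[ℂ] X))‖ ≤
        Real.exp (η / 2 * ‖z‖ ^ m) := by
    intro t ht
    refine (hbd (z • (F n - F₀) + t • F₀)
      ((((hF n).sub (hF n₀)).smul z).add ((hF n₀).smul t))).trans (Real.exp_le_exp.2 ?_)
    have h1 : N (z • (F n - F₀) + t • F₀) ≤ q * (2 * δ) * ‖z‖ := by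
      refine (hN.add_le _ _).trans ?_
      rw [hN.smul_eq, hN.smul_eq]
      calc q * (‖z‖ * N (F n - F₀) + ‖t‖ * N F₀) ≤ q * (‖z‖ * δ + 1 * a) := by gcongr
        _ ≤ q * (‖z‖ * δ + ‖z‖ * δ) := by rw [one_mul]; gcongr
        _ = _ := by ring
    have h2 : N (z • (F n - F₀) + t • F₀) ^ p ≤ (q * (2 * δ)) ^ m * ‖z‖ ^ m := by
      rw [← hpm, Real.rpow_natCast, ← mul_pow]
      exact pow_le_pow_left₀ (hN.nonneg _) h1 m
    calc c * N (z • (F n - F₀) + t • F₀) ^ p ≤ c * ((q * (2 * δ)) ^ m * ‖z‖ ^ m) := by gcongr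
      _ = c * (q * (2 * δ)) ^ m * ‖z‖ ^ m := by ring
      _ ≤ _ := by gcongr
  have hnorm : ‖((F n - F₀ : 𝓘) : X →L[ℂ] X)‖ + ‖(F₀ : X →L[ℂ] X)‖ ≤ b := by
    have h1 := hop (F n - F₀)
    have h2 := hop F₀
    linarith
  have key := norm_regDet_le_of_finiteRank_perturbation (p := p) (E := ((F n - F₀ : 𝓘) : X →L[ℂ] X))
    (G := (F₀ : X →L[ℂ] X)) ((hF n).sub (hF n₀)) (hF n₀) (r := r) le_rfl hnorm (by linarith) hz1 hT
  have hsum : z • ((F n - F₀ : 𝓘) : X →L[ℂ] X) + z • (F₀ : X →L[ℂ] X) = z • (F n : X →L[ℂ] X) := by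
    rw [← smul_add, Submodule.coe_sub, sub_add_cancel]
  rw [hsum] at key
  refine key.trans ?_
  have hz0 : 0 < ‖z‖ := by linarith
  have hpow : ‖z‖ ^ r = Real.exp (r * Real.log ‖z‖) := by
    rw [mul_comm, Real.exp_mul, Real.exp_log hz0, Real.rpow_natCast]
  rw [hpow, ← Real.exp_add, Real.exp_le_exp]
  have h5 := hR₁ ‖z‖ hzR
  have h6 : 2 * (m * (2 * r * (‖z‖ * b) ^ (m - 1))) =
      2 * (m * (2 * r * b ^ (m - 1))) * ‖z‖ ^ (m - 1) := by
    rw [mul_pow]; ring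
  rw [h6]
  linarith

/-- The sum of the `p`-th powers of the small eigenvalues is uniformly small along a convergent
sequence of finite rank operators, if `p` is an integer. -/
theorem exists_forall_norm_sum_small_pow_le (hp : 0 < p) (hpm : (⌈p⌉₊ : ℝ) = p)
    (hN : IsQuasiNorm N q) (hc : 0 ≤ c) (hop : ∀ L : 𝓘, ‖(L : X →L[ℂ] X)‖ ≤ N L)
    (hbd : ∀ F : 𝓘, IsFiniteRank (F : X →L[ℂ] X) →
      ‖regDet p (F : X →L[ℂ] X)‖ ≤ Real.exp (c * N F ^ p))
    {L : 𝓘} {F : ℕ → 𝓘} (hF : ∀ n, IsFiniteRank (F n : X →L[ℂ] X))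
    (hlim : Tendsto (fun n => N (F n - L)) atTop (𝓝 0)) {η ρ₁ : ℝ} (hη : 0 < η) (hρ₁ : 0 < ρ₁) :
    ∃ ρ > 0, ρ ≤ ρ₁ ∧ ∀ᶠ n in atTop,
      ‖(((nonzeroEigenvalues (F n : X →L[ℂ] X)).filter fun μ => ¬ ρ ≤ ‖μ‖).map
        (· ^ ⌈p⌉₊)).sum‖ ≤ η := by
  have hm : 0 < ⌈p⌉₊ := Nat.ceil_pos.2 hp
  have hm' : (0 : ℝ) < ⌈p⌉₊ := by exact_mod_cast hm
  -- The `m` roots of unity turn `η / (8 m)` into `η / 8`, and the `8` is the one in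
  -- `norm_sum_le_of_norm_prod_le`.
  obtain ⟨R₀, hR₀, hgrowth⟩ := exists_forall_norm_regDet_smul_le hp hpm hN hc hop hbd hF hlim
    (η := η / (8 * ⌈p⌉₊)) (by positivity)
  set m := ⌈p⌉₊
  set ρ := min ρ₁ (1 / R₀) with hρdef
  have hρ : 0 < ρ := lt_min hρ₁ (by positivity)
  refine ⟨ρ, hρ, min_le_left _ _, ?_⟩
  filter_upwards [hgrowth] with n hn
  -- On `‖w‖ = R` the large eigenvalues have `‖w μ^m‖ ≥ 2`, so their factors have modulus at least
  -- `1` and can be dropped; the small ones have `‖μ^m‖ R ≤ 2`, as the coefficient bound requires.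
  -- Since `ρ ≤ 1 / R₀`, every `m`-th root `z` of `w` satisfies `‖z‖ ≥ R₀`.
  set R := 2 / ρ ^ m
  have hR : 0 < R := by positivity
  have hR₀R : R₀ ^ m ≤ R := by
    have h1 : ρ * R₀ ≤ 1 := by
      calc ρ * R₀ ≤ 1 / R₀ * R₀ := by gcongr; exact min_le_right _ _
        _ = 1 := by field_simp
    rw [le_div_iff₀ (by positivity), ← mul_pow, mul_comm]
    exact (pow_le_one₀ (by positivity) h1).trans (by norm_num)
  set s := nonzeroEigenvalues (F n : X →L[ℂ] X)
  have hall : ∀ w : ℂ, ‖w‖ = R →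
      ‖(s.map fun μ => 1 - w * μ ^ m).prod‖ ≤ Real.exp (η / 8 * R) := by
    intro w hw
    obtain ⟨z, rfl⟩ := IsAlgClosed.exists_pow_nat_eq w hm
    rw [norm_pow] at hw
    have hz : R₀ ≤ ‖z‖ := by
      rw [← hw] at hR₀R
      exact le_of_pow_le_pow_left₀ hm.ne' (norm_nonneg _) hR₀R
    have hz0 : z ≠ 0 := norm_pos_iff.1 (by linarith)
    rw [← prod_regDet_nthRoots_smul hp hz0 (hF n), norm_prod]
    calc _ ≤ ∏ ω ∈ Polynomial.nthRootsFinset m (1 : ℂ), Real.exp (η / (8 * m) * R) := by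
          refine Finset.prod_le_prod (fun _ _ => norm_nonneg _) fun ω hω => ?_
          rw [Polynomial.mem_nthRootsFinset hm] at hω
          have hω1 : ‖ω‖ = 1 := Complex.norm_eq_one_of_pow_eq_one hω hm.ne'
          have h1 := hn (ω * z) (by rw [norm_mul, hω1, one_mul]; exact hz)
          rwa [norm_mul, hω1, one_mul, hw] at h1
      _ = Real.exp (η / 8 * R) := by
          rw [Finset.prod_const, (Complex.isPrimitiveRoot_exp m hm.ne').card_nthRootsFinset,
            ← Real.exp_nat_mul]
          congr 1
          field_simp
  have hsmall : ∀ w : ℂ, ‖w‖ = R →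
      ‖((s.filter fun μ => ¬ ρ ≤ ‖μ‖).map fun μ => 1 - w * μ ^ m).prod‖ ≤
        Real.exp (η / 8 * R) := by
    intro w hw
    refine le_trans ?_ (hall w hw)
    conv_rhs => rw [← Multiset.filter_add_not (fun μ : ℂ => ρ ≤ ‖μ‖) s]
    rw [Multiset.map_add, Multiset.prod_add, norm_mul]
    refine le_mul_of_one_le_left (norm_nonneg _) ?_
    have hlarge : ∀ t : Multiset ℂ, (∀ μ ∈ t, ρ ≤ ‖μ‖) →
        1 ≤ ‖(t.map fun μ => 1 - w * μ ^ m).prod‖ := by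
      intro t
      induction t using Multiset.induction with
      | empty => simp
      | cons μ t ih =>
        intro ht
        rw [Multiset.map_cons, Multiset.prod_cons, norm_mul]
        have h1 := ih fun ν hν => ht ν (Multiset.mem_cons_of_mem hν)
        have h2 : 2 ≤ ‖w * μ ^ m‖ := by
          rw [norm_mul, norm_pow, hw]
          calc (2 : ℝ) = R * ρ ^ m := by simp only [R]; field_simp
            _ ≤ _ := by
              gcongr
              exact ht μ (Multiset.mem_cons_self _ _)
        have h3 : 1 ≤ ‖1 - w * μ ^ m‖ := by
          have := norm_sub_norm_le (w * μ ^ m) 1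
          rw [norm_one, norm_sub_rev] at this
          linarith
        exact one_le_mul_of_one_le_of_one_le h3 h1
    exact hlarge _ fun μ hμ => (Multiset.mem_filter.1 hμ).2
  obtain ⟨f, hf⟩ := exists_fin_map_eq (s.filter fun μ => ¬ ρ ≤ ‖μ‖) rfl
  rw [← hf, Multiset.map_map]
  have hfmem : ∀ i, ‖f i‖ ≤ ρ := by
    intro i
    have h1 : f i ∈ s.filter fun μ => ¬ ρ ≤ ‖μ‖ := by
      rw [← hf]
      exact Multiset.mem_map_of_mem _ (Finset.mem_univ i)
    exact (not_le.1 (Multiset.mem_filter.1 h1).2).le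
  have key := norm_sum_le_of_norm_prod_le (fun i => f i ^ m) hR (M := η / 8 * R) (by positivity)
    (fun i => ?_) (fun w hw => ?_)
  · refine key.trans (le_of_eq ?_)
    field_simp
  · rw [norm_pow]
    calc ‖f i‖ ^ m * R ≤ ρ ^ m * R := by
          gcongr
          exact hfmem i
      _ = 2 := by simp only [R]; field_simp
  · have h1 := hsmall w hw
    rw [← hf, Multiset.map_map] at h1
    exact h1

end Growth

/-! ### The contribution of the small eigenvalues. -/

section Tail

open Filter

/-- A product of Weierstrass factors of genus above `p` is close to `1` in modulus, if the zeros are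
small and their `p`-th powers have a bounded sum. -/
theorem exists_forall_norm_prod_weierstrassFactor_le {p : ℝ} (hp : 0 < p) {m : ℕ} (hpm : p < m)
    (C : ℝ) {ε : ℝ} (hε : 0 < ε) :
    ∃ ρ > 0, ∀ s : Multiset ℂ, (∀ μ ∈ s, ‖μ‖ ≤ ρ) → (s.map fun μ => ‖μ‖ ^ p).sum ≤ C →
      ‖(s.map (weierstrassFactor m)).prod‖ ≤ Real.exp ε := by
  have hm : 1 ≤ m := by
    have : (0 : ℝ) < m := hp.trans hpm
    exact_mod_cast this
  have hmp : 0 < (m : ℝ) - p := sub_pos.2 hpm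
  set a := ε / (2 * (|C| + 1))
  have ha : 0 < a := by positivity
  -- This radius gives `‖μ‖ ^ m ≤ a ‖μ‖ ^ p`, where the surplus exponent `m - p > 0` is spent.
  refine ⟨min (1 / 2) (a ^ ((m : ℝ) - p)⁻¹), by positivity, fun s hs hsum => ?_⟩
  have h1 : ∀ μ ∈ s, ‖weierstrassFactor m μ‖ ≤ Real.exp (2 * a * ‖μ‖ ^ p) := by
    intro μ hμ
    obtain ⟨h2, h3⟩ := le_min_iff.1 (hs μ hμ)
    refine (norm_weierstrassFactor_le_of_norm_le_half hm h2).trans (Real.exp_le_exp.2 ?_)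
    have h4 : ‖μ‖ ^ ((m : ℝ) - p) ≤ a := by
      calc _ ≤ (a ^ ((m : ℝ) - p)⁻¹) ^ ((m : ℝ) - p) := by gcongr
        _ = a := Real.rpow_inv_rpow ha.le hmp.ne'
    have h5 : ‖μ‖ ^ m = ‖μ‖ ^ ((m : ℝ) - p) * ‖μ‖ ^ p := by
      rw [← Real.rpow_add_of_nonneg (norm_nonneg _) hmp.le hp.le, sub_add_cancel,
        Real.rpow_natCast]
    rw [h5, mul_assoc]
    gcongr
  refine (norm_prod_map_le_exp s h1).trans (Real.exp_le_exp.2 ?_)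
  rw [Multiset.sum_map_mul_left]
  calc 2 * a * (s.map fun μ => ‖μ‖ ^ p).sum ≤ 2 * a * (|C| + 1) := by
        gcongr
        linarith [le_abs_self C]
    _ = ε := by
        simp only [a]
        field_simp

variable {X : Type u} [NormedAddCommGroup X] [NormedSpace ℂ X]
  {𝓘 : Submodule ℂ (X →L[ℂ] X)} {N : 𝓘 → ℝ} {p q c : ℝ}

/-- The small eigenvalues contribute asymptotically nothing to the regularized determinant. -/
theorem exists_forall_norm_prod_small_le (hp : 0 < p) (hN : IsQuasiNorm N q) (hc : 0 ≤ c)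
    (hop : ∀ L : 𝓘, ‖(L : X →L[ℂ] X)‖ ≤ N L)
    (hbd : ∀ F : 𝓘, IsFiniteRank (F : X →L[ℂ] X) →
      ‖regDet p (F : X →L[ℂ] X)‖ ≤ Real.exp (c * N F ^ p))
    {L : 𝓘} {F : ℕ → 𝓘} (hF : ∀ n, IsFiniteRank (F n : X →L[ℂ] X))
    (hlim : Tendsto (fun n => N (F n - L)) atTop (𝓝 0)) {C ε : ℝ}
    (hC : ∀ᶠ n in atTop,
      ((nonzeroEigenvalues (F n : X →L[ℂ] X)).map fun μ => ‖μ‖ ^ p).sum ≤ C) (hε : 0 < ε) :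
    ∃ ρ > 0, ∀ᶠ n in atTop,
      ‖(((nonzeroEigenvalues (F n : X →L[ℂ] X)).filter fun μ => ¬ ρ ≤ ‖μ‖).map
        (weierstrassFactor ⌈p⌉₊)).prod‖ ≤ Real.exp ε := by
  have hsum : ∀ (s : Multiset ℂ) (ρ : ℝ), (s.map fun μ => ‖μ‖ ^ p).sum ≤ C →
      ((s.filter fun μ => ¬ ρ ≤ ‖μ‖).map fun μ => ‖μ‖ ^ p).sum ≤ C := by
    intro s ρ h
    have h1 := Multiset.filter_add_not (fun μ : ℂ => ρ ≤ ‖μ‖) s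
    have h2 := congrArg (fun s : Multiset ℂ => (s.map fun μ => ‖μ‖ ^ p).sum) h1
    simp only [Multiset.map_add, Multiset.sum_add] at h2
    linarith [sum_map_norm_rpow_nonneg p (s.filter fun μ => ρ ≤ ‖μ‖)]
  have hm : 1 ≤ ⌈p⌉₊ := Nat.one_le_ceil_iff.2 hp
  -- If `⌈p⌉ > p`, absolute values suffice. If `p` is integral there is no surplus exponent: the
  -- genus is raised by one, and the difference is the exponential of a power sum, which is small
  -- through cancellation rather than in absolute value.
  rcases (Nat.le_ceil p).lt_or_eq with hpm | hpm
  · obtain ⟨ρ, hρ, h⟩ := exists_forall_norm_prod_weierstrassFactor_le hp hpm C hε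
    refine ⟨ρ, hρ, hC.mono fun n hn => h _ (fun μ hμ => ?_) (hsum _ ρ hn)⟩
    exact (not_le.1 (Multiset.mem_filter.1 hμ).2).le
  · have hpm' : p < ((⌈p⌉₊ + 1 : ℕ) : ℝ) := by
      push_cast
      linarith
    obtain ⟨ρ₁, hρ₁, h⟩ := exists_forall_norm_prod_weierstrassFactor_le hp hpm' C
      (half_pos hε)
    obtain ⟨ρ, hρ, hρρ, hpow⟩ := exists_forall_norm_sum_small_pow_le hp hpm.symm hN hc hop hbd hF
      hlim (half_pos hε) hρ₁
    refine ⟨ρ, hρ, ?_⟩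
    filter_upwards [hC, hpow] with n hn hn'
    set s := (nonzeroEigenvalues (F n : X →L[ℂ] X)).filter fun μ => ¬ ρ ≤ ‖μ‖ with hs
    have h1 := h s (fun μ hμ => (not_le.1 (Multiset.mem_filter.1 hμ).2).le.trans hρρ)
      (hsum _ ρ hn)
    have h2 : (s.map (weierstrassFactor ⌈p⌉₊)).prod =
        (s.map (weierstrassFactor (⌈p⌉₊ + 1))).prod *
          Complex.exp (-(1 / (⌈p⌉₊ : ℂ)) * (s.map (· ^ ⌈p⌉₊)).sum) := by
      rw [← Multiset.sum_map_mul_left, Complex.exp_multiset_sum, Multiset.map_map,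
        ← Multiset.prod_map_mul]
      refine congrArg _ (Multiset.map_congr rfl fun u _ => ?_)
      rw [weierstrassFactor_succ hm, Function.comp_apply, mul_assoc, ← Complex.exp_add]
      simp
    rw [h2, norm_mul]
    calc _ ≤ Real.exp (ε / 2) * Real.exp (ε / 2) := by
          gcongr
          refine (Complex.norm_exp_le_exp_norm _).trans (Real.exp_le_exp.2 ?_)
          rw [norm_mul, norm_neg, norm_div, norm_one, Complex.norm_natCast]
          refine (mul_le_of_le_one_left (norm_nonneg _) ?_).trans hn'
          exact div_le_one_of_le₀ (by exact_mod_cast hm) (by positivity)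
      _ = Real.exp ε := by rw [← Real.exp_add, add_halves]

end Tail

/-! ### Bounds for the extension on the ideal. -/

section Bound

open Filter

variable {X : Type u} [NormedAddCommGroup X] [NormedSpace ℂ X]
  {𝓘 : Submodule ℂ (X →L[ℂ] X)} {N : 𝓘 → ℝ} {p q γ Γ : ℝ}

theorem IsLpIdeal.eigenvalueSum_le (h : IsLpIdeal p 𝓘 N q γ) (hp : 0 < p) (L : 𝓘) :
    eigenvalueSum p (L : X →L[ℂ] X) ≤ ENNReal.ofReal (γ * N L) ^ p := by
  have h1 := ENNReal.rpow_le_rpow (h.eigenvalue_le L) hp.le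
  rwa [← ENNReal.rpow_mul, one_div_mul_cancel hp.ne', ENNReal.rpow_one] at h1

theorem IsLpIdeal.eigenvalueSum_ne_top (h : IsLpIdeal p 𝓘 N q γ) (hp : 0 < p) (L : 𝓘) :
    eigenvalueSum p (L : X →L[ℂ] X) ≠ ∞ :=
  ne_top_of_le_ne_top (ENNReal.rpow_ne_top_of_nonneg hp.le ENNReal.ofReal_ne_top)
    (h.eigenvalueSum_le hp L)

theorem IsLpIdeal.toReal_eigenvalueSum_le (h : IsLpIdeal p 𝓘 N q γ) (hp : 0 < p) (hγ : 0 ≤ γ)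
    (L : 𝓘) : (eigenvalueSum p (L : X →L[ℂ] X)).toReal ≤ γ ^ p * N L ^ p := by
  have hL := h.quasiNorm.nonneg L
  refine ENNReal.toReal_le_of_le_ofReal (by positivity) ?_
  rw [← Real.mul_rpow hγ hL, ← ENNReal.ofReal_rpow_of_nonneg (by positivity) hp.le]
  exact h.eigenvalueSum_le hp L

theorem IsLpIdeal.norm_regDet_le (h : IsLpIdeal p 𝓘 N q γ) (hp : 0 < p) (hγ : 0 ≤ γ)
    (hΓ : IsGrowthConstant X p Γ) (F : 𝓘) (hF : IsFiniteRank (F : X →L[ℂ] X)) :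
    ‖regDet p (F : X →L[ℂ] X)‖ ≤ Real.exp (γ ^ p * Γ * N F ^ p) := by
  refine (hΓ.2 _ hF).trans (Real.exp_le_exp.2 ?_)
  have := mul_le_mul_of_nonneg_left (h.toReal_eigenvalueSum_le hp hγ F) hΓ.1.le
  linarith

theorem card_filter_le_div_rpow (hp : 0 < p) {ρ : ℝ} (hρ : 0 < ρ) (s : Multiset ℂ) :
    ((s.filter fun μ => ρ ≤ ‖μ‖).card : ℝ) ≤ (s.map fun μ => ‖μ‖ ^ p).sum / ρ ^ p := by
  rw [le_div_iff₀ (by positivity)]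
  have h1 : ((s.filter fun μ => ρ ≤ ‖μ‖).card : ℝ) * ρ ^ p ≤
      ((s.filter fun μ => ρ ≤ ‖μ‖).map fun μ => ‖μ‖ ^ p).sum := by
    rw [← nsmul_eq_mul, ← Multiset.sum_replicate, ← Multiset.map_const']
    refine Multiset.sum_map_le_sum_map _ _ fun μ hμ => ?_
    have := (Multiset.mem_filter.1 hμ).2
    gcongr
  have h2 := congrArg (fun s : Multiset ℂ => (s.map fun μ => ‖μ‖ ^ p).sum)
    (Multiset.filter_add_not (fun μ : ℂ => ρ ≤ ‖μ‖) s)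
  simp only [Multiset.map_add, Multiset.sum_add] at h2
  linarith [sum_map_norm_rpow_nonneg p (s.filter fun μ => ¬ ρ ≤ ‖μ‖)]

theorem IsLpIdeal.mono (h : IsLpIdeal p 𝓘 N q γ) {γ' : ℝ} (hγ : γ ≤ γ') :
    IsLpIdeal p 𝓘 N q γ' :=
  { h with
    eigenvalue_le := fun L => (h.eigenvalue_le L).trans (ENNReal.ofReal_le_ofReal
      (mul_le_mul_of_nonneg_right hγ (h.quasiNorm.nonneg L))) }

theorem IsLpIdeal.existsUnique_isContinuousDetExtension (h : IsLpIdeal p 𝓘 N q γ) (hp : 0 < p)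
    (hΓ : IsGrowthConstant X p Γ) : ∃! D : 𝓘 → ℂ, IsContinuousDetExtension p 𝓘 N D := by
  -- The sign of `γ` is not assumed; existence and uniqueness need only some nonnegative eigenvalue
  -- constant.
  have h' := h.mono (le_abs_self γ)
  have hΓ0 := hΓ.1
  have hc : 0 ≤ |γ| ^ p * Γ := by positivity
  have hbd := h'.norm_regDet_le hp (abs_nonneg γ) hΓ
  obtain ⟨D, hD⟩ := exists_isDetLimit hp h.quasiNorm hc hbd h.finiteRank_dense
  exact ⟨D, hD.isContinuousDetExtension hp h.quasiNorm hc hbd h.finiteRank_dense, fun D' hD' =>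
    hD'.isDetLimit.unique h.quasiNorm h.finiteRank_dense hD⟩

variable [CompleteSpace X]

/-- The growth estimate for finite rank operators passes to the limit with the same constant. -/
theorem IsLpIdeal.norm_le_exp_eigenvalueSum (h : IsLpIdeal p 𝓘 N q γ) (hp : 0 < p) (hγ : 0 ≤ γ)
    (hΓ : IsGrowthConstant X p Γ) {D : 𝓘 → ℂ} (hD : IsDetLimit p 𝓘 N D) (L : 𝓘) :
    ‖D L‖ ≤ Real.exp (Γ * (eigenvalueSum p (L : X →L[ℂ] X)).toReal) := by
  have hN := h.quasiNorm
  have hΓ0 := hΓ.1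
  obtain ⟨F, hF, hlim⟩ := hN.exists_seq_of_dense h.finiteRank_dense L
  have hlim' : Tendsto (fun n => (F n : X →L[ℂ] X)) atTop (𝓝 (L : X →L[ℂ] X)) := by
    rw [tendsto_iff_norm_sub_tendsto_zero]
    exact squeeze_zero (fun n => norm_nonneg _) (fun n => h.opNorm_le (F n - L)) hlim
  have hcomp : IsCompactOperator (L : X →L[ℂ] X) :=
    isCompactOperator_of_tendsto hlim' (Eventually.of_forall fun n => (hF n).isCompactOperator)
  set C := γ ^ p * (q * (1 + N L)) ^ p
  have hC : ∀ᶠ n in atTop,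
      ((nonzeroEigenvalues (F n : X →L[ℂ] X)).map fun μ => ‖μ‖ ^ p).sum ≤ C := by
    filter_upwards [hlim.eventually_lt_const one_pos] with n hn
    rw [← toReal_eigenvalueSum hp (hF n)]
    refine (h.toReal_eigenvalueSum_le hp hγ _).trans ?_
    have h1 := hN.nonneg (F n)
    have h2 := hN.add_le (F n - L) L
    rw [sub_add_cancel] at h2
    have hq := hN.pos
    have h3 : N (F n) ≤ q * (1 + N L) := h2.trans (by gcongr)
    exact mul_le_mul_of_nonneg_left (Real.rpow_le_rpow h1 h3 hp.le) (by positivity)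
  have hkey : ∀ ε > 0,
      ‖D L‖ ≤ Real.exp (Γ * ((eigenvalueSum p (L : X →L[ℂ] X)).toReal + ε) + ε) := by
    intro ε hε
    obtain ⟨ρ, hρ, hsmall⟩ := exists_forall_norm_prod_small_le hp hN
      (c := γ ^ p * Γ) (by positivity) h.opNorm_le (h.norm_regDet_le hp hγ hΓ) hF hlim hC hε
    have hcard : ∀ᶠ n in atTop,
        ((nonzeroEigenvalues (F n : X →L[ℂ] X)).filter fun μ => ρ ≤ ‖μ‖).card ≤
          ⌈C / ρ ^ p⌉₊ := by
      filter_upwards [hC] with n hn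
      have h1 : (((nonzeroEigenvalues (F n : X →L[ℂ] X)).filter fun μ => ρ ≤ ‖μ‖).card : ℝ) ≤
          ⌈C / ρ ^ p⌉₊ :=
        (card_filter_le_div_rpow hp hρ _).trans (le_trans (by gcongr) (Nat.le_ceil _))
      exact_mod_cast h1
    have hlarge := eventually_sum_filter_le_eigenvalueSum hp hcomp hF hlim'
      (h.eigenvalueSum_ne_top hp L) hρ hcard hε
    refine le_of_tendsto (hD L F hF hlim).norm ?_
    filter_upwards [hsmall, hlarge] with n hn1 hn2
    -- The large eigenvalues are estimated with `Γ` and their limiting sum, the small ones by `exp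
    -- ε`.
    rw [regDet_eq_prod p (hF n), ← Multiset.filter_add_not (fun μ : ℂ => ρ ≤ ‖μ‖)
      (nonzeroEigenvalues (F n : X →L[ℂ] X)), Multiset.map_add, Multiset.prod_add, norm_mul,
      Real.exp_add]
    have h3 := hΓ.norm_prod_le hp (hF n) (Multiset.filter_le (fun μ : ℂ => ρ ≤ ‖μ‖) _)
    gcongr
    exact h3.trans (Real.exp_le_exp.2 (by gcongr))
  have ht : Tendsto (fun ε : ℝ =>
      Real.exp (Γ * ((eigenvalueSum p (L : X →L[ℂ] X)).toReal + ε) + ε)) (𝓝[>] 0)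
      (𝓝 (Real.exp (Γ * (eigenvalueSum p (L : X →L[ℂ] X)).toReal))) := by
    have h1 : Continuous fun ε : ℝ =>
        Real.exp (Γ * ((eigenvalueSum p (L : X →L[ℂ] X)).toReal + ε) + ε) := by fun_prop
    have h2 := h1.tendsto 0
    simp only [add_zero] at h2
    exact h2.mono_left nhdsWithin_le_nhds
  exact ge_of_tendsto ht (eventually_mem_nhdsWithin.mono fun ε hε => hkey ε hε)

theorem IsLpIdeal.norm_le_exp (h : IsLpIdeal p 𝓘 N q γ) (hp : 0 < p) (hγ : 0 ≤ γ)
    (hΓ : IsGrowthConstant X p Γ) {D : 𝓘 → ℂ} (hD : IsDetLimit p 𝓘 N D) (L : 𝓘) :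
    ‖D L‖ ≤ Real.exp (γ ^ p * Γ * N L ^ p) := by
  refine (h.norm_le_exp_eigenvalueSum hp hγ hΓ hD L).trans (Real.exp_le_exp.2 ?_)
  have := mul_le_mul_of_nonneg_left (h.toReal_eigenvalueSum_le hp hγ L) hΓ.1.le
  linarith

theorem IsLpIdeal.norm_sub_le (h : IsLpIdeal p 𝓘 N q γ) (hp : 0 < p) (hγ : 0 ≤ γ)
    (hΓ : IsGrowthConstant X p Γ) {D : 𝓘 → ℂ} (hD : IsDetLimit p 𝓘 N D) (K L : 𝓘) :
    ‖D K - D L‖ ≤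
      N (K - L) * Real.exp (q ^ (2 * p) * γ ^ p * Γ * (N K + N L + 1) ^ p) := by
  have hΓ0 := hΓ.1
  have hc : 0 ≤ γ ^ p * Γ := by positivity
  have h1 := h.quasiNorm.norm_sub_le_of_norm_le_exp hp hc K L
    (hD.differentiable hp h.quasiNorm hc (h.norm_regDet_le hp hγ hΓ) h.finiteRank_dense _ _)
    fun z => h.norm_le_exp hp hγ hΓ hD _
  rwa [← mul_assoc] at h1

/-- A negative eigenvalue constant is only possible on the trivial space. -/
theorem IsLpIdeal.subsingleton_of_neg (h : IsLpIdeal p 𝓘 N q γ) (hp : 0 < p) (hγ : γ < 0) :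
    Subsingleton X := by
  by_contra hX
  rw [not_subsingleton_iff_nontrivial] at hX
  obtain ⟨x, hx⟩ := exists_ne (0 : X)
  -- `G` has the eigenvalue `1`, whereas `ENNReal.ofReal` of a nonpositive number is `0` and would
  -- force its eigenvalue sum to vanish.
  obtain ⟨G, hG, hGt⟩ := exists_isFiniteRank_nonzeroEigenvalues_eq (ℂ ∙ x) {1} (by simp)
    (by rw [finrank_span_singleton hx]; simp)
  have h1 := h.eigenvalueSum_le hp ⟨G, h.finiteRank_mem G hG⟩
  rw [ENNReal.ofReal_of_nonpos (mul_nonpos_of_nonpos_of_nonneg hγ.le (h.quasiNorm.nonneg _)),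
    ENNReal.zero_rpow_of_pos hp] at h1
  have h2 := toReal_eigenvalueSum hp hG
  rw [nonpos_iff_eq_zero.1 h1, hGt] at h2
  simp at h2

end Bound

theorem theorem4p3 (p : ℝ) (hp : 0 < p) :
    (∃ Γ : ℝ, ∀ (X : Type u) [NormedAddCommGroup X] [NormedSpace ℂ X] [CompleteSpace X],
      IsGrowthConstant X p Γ) ∧
    ∀ (X : Type u) [NormedAddCommGroup X] [NormedSpace ℂ X] [CompleteSpace X]
      (𝓘 : Submodule ℂ (X →L[ℂ] X)) (N : 𝓘 → ℝ) (q γ : ℝ), IsLpIdeal p 𝓘 N q γ →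
      (∃! D : 𝓘 → ℂ, IsContinuousDetExtension p 𝓘 N D) ∧
      ∀ D : 𝓘 → ℂ, IsContinuousDetExtension p 𝓘 N D →
        ∀ Γ : ℝ, IsGrowthConstant X p Γ →
          (∀ L : 𝓘, ‖D L‖ ≤ Real.exp (γ ^ p * Γ * N L ^ p)) ∧
          (∀ K L : 𝓘, ‖D K - D L‖ ≤
            N (K - L) * Real.exp (q ^ (2 * p) * γ ^ p * Γ * (N K + N L + 1) ^ p)) := by
  obtain ⟨Γ₀, hΓ₀, hw⟩ := exists_norm_weierstrassFactor_le hp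
  refine ⟨⟨Γ₀, fun X _ _ _ => isGrowthConstant_of_norm_weierstrassFactor_le hp hΓ₀ hw⟩,
    fun X _ _ _ 𝓘 N q γ h => ⟨h.existsUnique_isContinuousDetExtension hp
      (isGrowthConstant_of_norm_weierstrassFactor_le hp hΓ₀ hw), fun D hD Γ hΓ => ?_⟩⟩
  rcases le_or_gt 0 γ with hγ | hγ
  · exact ⟨h.norm_le_exp hp hγ hΓ hD.isDetLimit, h.norm_sub_le hp hγ hΓ hD.isDetLimit⟩
  · have hX := h.subsingleton_of_neg hp hγ
    have hzero : ∀ L : 𝓘, L = 0 := fun L => Subtype.ext (ContinuousLinearMap.ext fun x =>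
      Subsingleton.elim _ _)
    have hN0 : N 0 = 0 := (h.quasiNorm.eq_zero_iff 0).2 rfl
    refine ⟨fun L => ?_, fun K L => ?_⟩
    -- On the trivial space constant `0` is also admissible, and `N 0 = 0` makes the value of `γ ^
    -- p` for negative `γ` irrelevant.
    · have h1 := (h.mono hγ.le).norm_le_exp hp le_rfl hΓ hD.isDetLimit L
      rw [hzero L, hN0, Real.zero_rpow hp.ne', mul_zero] at h1 ⊢
      exact h1
    · rw [hzero K, hzero L, sub_self, sub_self, hN0, zero_mul, norm_zero]
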